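/- Let $1<p<r<2$ and $\frac1p+\frac1{p^*}=1$. An Orlicz function is a convex $M:[0,\infty)\to[0,\infty)$ with $M(0)=0$ and $M(t)>0$ for $t>0$; put $\|x\|_M=\inf\{\rho>0:\sum_i M(|x_i|/\rho)\le 1\}$ for $x\in\mathbb R^n$, $M^*(s)=\sup_{t\ge0}(st-M(t))\in[0,\infty]$ and $M^{*-1}(u)=\sup\{s\ge0: M^*(s)\le u\}$. For $n\in\mathbb N$ and $y\in\mathbb R^n\setminus\{0\}$ with $y_1\ge\dots\ge y_n\ge0$ put $$\Phi_y(\ell)=\frac1n\sum_{i=1}^{\ell}y_i+\Big(\frac{\ell}{n}\Big)^{1/p^*}\Big(\frac1n\sum_{i=\ell+1}^n|y_i|^p\Big)^{1/p},\qquad \ell=1,\dots,n,$$ and let $x_i=(n/i)^{1/r}$, $z_j=(n/j)^{1/p}$ for $1\le i,j\le n$. (a) There are constants $A,B>0$ depending only on $r$ and $p$ such that for all such $n$ and $y$ there is an Orlicz function $M_y$ with $$A\,\Phi_y(\ell)\le M_y^{*-1}\Big(\frac{\ell}{n}\Big)\le B\,\Phi_y(\ell)\qquad(\ell=1,\dots,n).\tag{1}$$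 (b) For all $A,B>0$ there are constants $a,b>0$ and $C$, depending only on $r,p,A,B$, such that for all such $n$ and $y$ and every Orlicz function $M_y$ satisfying (1) the following hold. For all real matrices $(a_{ij})_{i,j=1}^n$, $$a\,\big\|\big(\|(a_{ij})_{i=1}^n\|_r\big)_{j=1}^n\big\|_{M_y}\le\frac1{(n!)^3}\sum_{\pi,\sigma,\eta}\Big(\sum_{i,j=1}^n|a_{ij}x_{\pi(i)}y_{\sigma(j)}z_{\eta(j)}|^2\Big)^{1/2}\le b\,\big\|\big(\|(a_{ij})_{i=1}^n\|_r\big)_{j=1}^n\big\|_{M_y},$$ where $\pi,\sigma,\eta$ run over all permutations of $\{1,\dots,n\}$. Moreover, $\ell^n_{M_y}(\ell^n_r)$, that is, the space of real $n\times n$ matrices with the norm $\|(\|(a_{ij})_{i}\|_r)_{j}\|_{M_y}$, is uniformly isomorphic to a subspace of $L_1[0,1]$: there is a linear isomorphism $T$ from it onto a subspace of $L_1[0,1]$ with $\|T\|\,\|T^{-1}\|\le C$. -/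

import Mathlib

open MeasureTheory

noncomputable section

/-- `M : [0,∞) → [0,∞)` is an Orlicz function: convex, `M 0 = 0`, `M t > 0` for `t > 0`.
The values of `M` on the negative half-line are irrelevant everywhere below. -/
structure IsOrlicz (M : ℝ → ℝ) : Prop where
  convexOn : ConvexOn ℝ (Set.Ici 0) M
  map_zero : M 0 = 0
  pos : ∀ t : ℝ, 0 < t → 0 < M t

/-- The dual function (Legendre transform) `M* s = sup_{t ≥ 0} (s t - M t)`.
It may take the value `+∞` (for instance if `M` is linear), hence it is extended-real valued. -/
def orliczDual (M : ℝ → ℝ) (s : ℝ) : EReal :=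
  ⨆ (t : ℝ) (_ : 0 ≤ t), ((s * t - M t : ℝ) : EReal)

/-- The inverse `M*⁻¹ u = sup {s ≥ 0 : M* s ≤ u}` of the dual function. For `u > 0` it is the
unique `s` with `M* s = u` whenever there is one. -/
def orliczDualInv (M : ℝ → ℝ) (u : ℝ) : ℝ :=
  sSup {s : ℝ | 0 ≤ s ∧ orliczDual M s ≤ (u : EReal)}

/-- The Luxemburg norm `‖x‖_M` on `ℝⁿ`. -/
def orliczNorm {n : ℕ} (M : ℝ → ℝ) (x : Fin n → ℝ) : ℝ :=
  sInf {ρ : ℝ | 0 < ρ ∧ ∑ i, M (|x i| / ρ) ≤ 1}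

/-- The norm of `ℓ_M^n(ℓ_r^n)` : the `M`-norm, over `j`, of the `ℓ_r`-norms of the vectors
`(a i j)_i`. -/
def mixedNorm {n : ℕ} (M : ℝ → ℝ) (r : ℝ) (a : Matrix (Fin n) (Fin n) ℝ) : ℝ :=
  orliczNorm M (fun j => ‖WithLp.toLp (ENNReal.ofReal r) (fun i => a i j)‖)

/-- The vector `((n/i)^{1/q})_{i=1,…,n}`; the index `i : Fin n` stands for `i + 1`. -/
def powerVec (n : ℕ) (q : ℝ) (i : Fin n) : ℝ :=
  ((n : ℝ) / ((i : ℝ) + 1)) ^ (1 / q)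

/-- `(n!)⁻³ ∑_{π,σ,η} (∑_{i,j} |a i j * x (π i) * y (σ j) * z (η j)|²)^{1/2}`. -/
def tripleAve {n : ℕ} (x y z : Fin n → ℝ) (a : Matrix (Fin n) (Fin n) ℝ) : ℝ :=
  (1 / (n.factorial : ℝ) ^ 3) *
    ∑ π : Equiv.Perm (Fin n), ∑ σ : Equiv.Perm (Fin n), ∑ η : Equiv.Perm (Fin n),
      Real.sqrt (∑ i, ∑ j, |a i j * x (π i) * y (σ j) * z (η j)| ^ 2)

/-- `(1/n) ∑_{i ≤ ℓ} y_i + (ℓ/n)^{1/p*} ((1/n) ∑_{i > ℓ} |y_i|^p)^{1/p}`, with `1/p* = 1 - 1/p`;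
the index `i : Fin n` stands for `i + 1`. -/
def targetFun {n : ℕ} (p : ℝ) (y : Fin n → ℝ) (l : ℕ) : ℝ :=
  (1 / (n : ℝ)) * (∑ i ∈ Finset.univ.filter (fun i : Fin n => (i : ℕ) < l), y i) +
    ((l : ℝ) / n) ^ (1 - 1 / p) *
      ((1 / (n : ℝ)) * ∑ i ∈ Finset.univ.filter (fun i : Fin n => l ≤ (i : ℕ)), |y i| ^ p) ^ (1 / p)

/-- `M*⁻¹(ℓ/n)` is equivalent, with constants `A` and `B`, to the expression `targetFun p y ℓ`,
for `ℓ = 1, …, n`. -/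
def IsAssociated {n : ℕ} (A B p : ℝ) (y : Fin n → ℝ) (M : ℝ → ℝ) : Prop :=
  ∀ l : ℕ, 1 ≤ l → l ≤ n →
    A * targetFun p y l ≤ orliczDualInv M ((l : ℝ) / n) ∧
      orliczDualInv M ((l : ℝ) / n) ≤ B * targetFun p y l

/-- The space `L₁[0,1]`. -/
abbrev LOne : Type := Lp ℝ 1 (volume.restrict (Set.Icc (0 : ℝ) 1))

/-- `V`, equipped with the norm `N`, is `C`-isomorphic to a subspace of `L₁[0,1]`: there is a linear
isomorphism `T` onto a subspace with `‖T‖ ≤ K`, `‖T⁻¹‖ ≤ L` and `K * L ≤ C`. -/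
def IsoSubspaceLOne {V : Type*} [AddCommGroup V] [Module ℝ V] (N : V → ℝ) (C : ℝ) : Prop :=
  ∃ (E : Submodule ℝ LOne) (T : V ≃ₗ[ℝ] E) (K L : ℝ), 0 < K ∧ 0 < L ∧ K * L ≤ C ∧
    (∀ v : V, ‖T v‖ ≤ K * N v) ∧ (∀ f : E, N (T.symm f) ≤ L * ‖f‖)

end

/-! The engine is a statement about one random permutation `σ`. For `s > 1` and decreasing `w ≥ 0`,
the mean of the `ℓ_s`-norm of `(u_j w_{σ(j)})_j` is equivalent to the Orlicz norm of `u` given by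
`avgOrlicz s w`. Indeed, at the scale where the norm is about 1, entries below 1 act through their
`s`-th powers, while rare entries above 1 contribute their own size; hence the power `t ^ s`
flattened to linear growth in `linPow`. The upper estimate is pointwise (`powNorm_le_one_add`). The
lower one (`le_permAvg_powNorm`) rests on the negative correlation of the values of a permutation
(`permAvg_mul_le`).

For `w_k = (n/k)^{1/q}` with `1 < q < s ≤ 2` this Orlicz function is essentially `t ^ q`, so
averaging turns `ℓ_s` into `ℓ_q` (`exists_permAvg_powerVec_equiv`). Averaging over `π` thus leaves
an `ℓ_r(ℓ_2)`-norm of the matrix `a_ij y_σ(j) z_η(j)`, with `i` the outer index. It lies between the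
`ℓ_2`-norm (Minkowski) and the `ℓ_r`-norm of the column `ℓ_r`-norms. Since `p < r < 2`, averaging
over `η` turns both bounds into the same `ℓ_p`-norm. Averaging over `σ` then yields the mixed norm
for `avgOrlicz p y`.

This function satisfies (1), which gives (a). Conversely, the values of `M*⁻¹` at the points `ℓ/n`
determine the Orlicz norm on `ℝⁿ` up to constants (`orliczNorm_le_of_orliczDualInv_le`), so every
admissible `M` may replace it. Finally, by Khintchine's inequality the square function is equivalent
to a mean over random signs, so the triple average is equivalent to an `L₁`-norm on a finite
probability space, realised by step functions on `[0,1]`. -/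

noncomputable section

/-! ### Elementary facts on Orlicz functions -/

namespace IsOrlicz

variable {M : ℝ → ℝ}

theorem nonneg (hM : IsOrlicz M) {t : ℝ} (ht : 0 ≤ t) : 0 ≤ M t := by
  rcases ht.eq_or_lt with rfl | h
  · exact hM.map_zero.ge
  · exact (hM.pos t h).le

theorem map_mul_le (hM : IsOrlicz M) {c t : ℝ} (hc : 0 ≤ c) (hc1 : c ≤ 1) (ht : 0 ≤ t) :
    M (c * t) ≤ c * M t := by
  have h := hM.convexOn.2 (Set.mem_Ici.2 ht) (Set.mem_Ici.2 le_rfl) hc (sub_nonneg.2 hc1)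
    (by ring)
  simpa [hM.map_zero] using h

end IsOrlicz

theorem orliczDual_le_iff {M : ℝ → ℝ} {s u : ℝ} :
    orliczDual M s ≤ (u : EReal) ↔ ∀ t, 0 ≤ t → s * t ≤ M t + u := by
  simp only [orliczDual, iSup_le_iff, EReal.coe_le_coe_iff, sub_le_iff_le_add']

/-! ### Young's inequality for the inverse dual function -/

section DualInv

variable {M : ℝ → ℝ}

theorem le_orliczDualInv {s u : ℝ} (hs : 0 ≤ s)
    (h : ∀ t, 0 ≤ t → s * t ≤ M t + u) : s ≤ orliczDualInv M u := by
  -- Testing at `t = 1` bounds the admissible slopes, so the real supremum is not the default value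
  -- `0`.
  refine le_csSup ⟨M 1 + u, ?_⟩ ⟨hs, orliczDual_le_iff.2 h⟩
  rintro x ⟨_, hx⟩
  simpa using orliczDual_le_iff.1 hx 1 zero_le_one

theorem orliczDualInv_nonneg {u : ℝ} : 0 ≤ orliczDualInv M u :=
  Real.sSup_nonneg fun _ hx => hx.1

/-- Young's inequality: it holds for each admissible slope and passes to the supremum. The slope `0`
is admissible because `M ≥ 0`. -/
theorem orliczDualInv_mul_le (hM : IsOrlicz M) {u t : ℝ} (hu : 0 ≤ u) (ht : 0 ≤ t) :
    orliczDualInv M u * t ≤ M t + u := by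
  rcases ht.eq_or_lt with rfl | h
  · simpa [hM.map_zero] using hu
  · rw [← le_div_iff₀ h]
    refine csSup_le ⟨0, le_rfl, orliczDual_le_iff.2 fun t ht => ?_⟩ ?_
    · have := hM.nonneg ht
      linarith
    · rintro x ⟨_, hx⟩
      rw [le_div_iff₀ h]
      exact orliczDual_le_iff.1 hx t ht

theorem exists_lt_of_orliczDualInv_lt (hM : IsOrlicz M) {u s : ℝ} (hu : 0 ≤ u)
    (h : orliczDualInv M u < s) : ∃ t, 0 < t ∧ M t + u < s * t := by
  by_contra! hc
  refine h.not_ge (le_orliczDualInv (orliczDualInv_nonneg.trans h.le) fun t ht => ?_)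
  rcases ht.eq_or_lt with rfl | ht
  · simpa [hM.map_zero] using hu
  · exact hc t ht

end DualInv

/-! ### Luxemburg norms and their comparison -/

section Norm

variable {n : ℕ} {M : ℝ → ℝ}

theorem orliczNorm_le {x : Fin n → ℝ} {ρ : ℝ} (hρ : 0 < ρ)
    (h : ∑ i, M (|x i| / ρ) ≤ 1) : orliczNorm M x ≤ ρ :=
  csInf_le ⟨0, fun _ h => h.1.le⟩ ⟨hρ, h⟩

/-- Convexity gives `M (c t) ≤ c M t` for `c ≤ 1`. The infimum defining the norm is therefore over a
nonempty set. -/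
theorem exists_sum_le_one (hM : IsOrlicz M) (x : Fin n → ℝ) :
    ∃ ρ : ℝ, 0 < ρ ∧ ∑ i, M (|x i| / ρ) ≤ 1 := by
  have hS : 0 ≤ ∑ i, M |x i| := Finset.sum_nonneg fun i _ => hM.nonneg (abs_nonneg _)
  refine ⟨1 + ∑ i, M |x i|, by positivity, ?_⟩
  calc ∑ i, M (|x i| / (1 + ∑ i, M |x i|))
      ≤ ∑ i, (1 + ∑ i, M |x i|)⁻¹ * M |x i| := Finset.sum_le_sum fun i _ => by
        rw [div_eq_inv_mul]
        exact hM.map_mul_le (by positivity) (inv_le_one_of_one_le₀ (by linarith)) (abs_nonneg _)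
    _ = (∑ i, M |x i|) / (1 + ∑ i, M |x i|) := by rw [← Finset.mul_sum, div_eq_inv_mul]
    _ ≤ 1 := by rw [div_le_one (by positivity)]; linarith

theorem le_orliczNorm (hM : IsOrlicz M) {x : Fin n → ℝ} {c : ℝ}
    (h : ∀ ρ, 0 < ρ → ∑ i, M (|x i| / ρ) ≤ 1 → c ≤ ρ) : c ≤ orliczNorm M x :=
  le_csInf (exists_sum_le_one hM x) fun ρ hρ => h ρ hρ.1 hρ.2

/-- Orlicz functions whose dual inverses are comparable at `ℓ / n` have comparable norms. -/
theorem orliczNorm_le_of_orliczDualInv_le {M₁ M₂ : ℝ → ℝ} (h₁ : IsOrlicz M₁) (h₂ : IsOrlicz M₂)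
    {K : ℝ} (hK : 0 < K) (h : ∀ l : ℕ, 1 ≤ l → l ≤ n →
      orliczDualInv M₁ ((l : ℝ) / n) ≤ K * orliczDualInv M₂ ((l : ℝ) / n)) (x : Fin n → ℝ) :
    orliczNorm M₁ x ≤ 6 * K * orliczNorm M₂ x := by
  -- Only the grid points `l/n` are available, so `M₂ t` is rounded up to the next one; this costs
  -- `1/n` per coordinate.
  have key : ∀ t, 0 ≤ t → M₂ t ≤ 1 → 0 < n → M₁ ((3 * K)⁻¹ * t) ≤ M₂ t + 1 / n := by
    intro t ht ht1 hn
    have hn' : (0 : ℝ) < n := by exact_mod_cast hn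
    rcases ht.eq_or_lt with rfl | ht
    · simp [h₁.map_zero, h₂.map_zero]
    have hpos := h₂.pos t ht
    obtain ⟨l, hl1, hln, hl, hl'⟩ : ∃ l : ℕ, 1 ≤ l ∧ l ≤ n ∧ M₂ t ≤ l / n ∧
        (l : ℝ) / n ≤ M₂ t + 1 / n := by
      refine ⟨⌈n * M₂ t⌉₊, Nat.one_le_ceil_iff.2 (by positivity), Nat.ceil_le.2 ?_, ?_, ?_⟩
      · nlinarith
      · rw [le_div_iff₀ hn', mul_comm]; exact Nat.le_ceil _
      · rw [div_le_iff₀ hn', add_mul, one_div, inv_mul_cancel₀ hn'.ne', mul_comm]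
        exact (Nat.ceil_lt_add_one (by positivity)).le
    have hu : (0 : ℝ) < l / n := by have : (0 : ℝ) < l := by exact_mod_cast hl1
                                    positivity
    have hs2 : orliczDualInv M₂ ((l : ℝ) / n) ≤ 2 * (l / n) / t := by
      rw [le_div_iff₀ ht]
      linarith [orliczDualInv_mul_le h₂ hu.le ht.le]
    -- Young's inequality gives the factor 2; replacing it by 3 makes the bound strict, so some `t'`
    -- violates the inequality for this slope. Convexity then carries the bound from `t'` down to `t
    -- / (3K)`.
    have hs1 : orliczDualInv M₁ ((l : ℝ) / n) < 3 * K * (l / n) / t := by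
      refine ((h l hl1 hln).trans (mul_le_mul_of_nonneg_left hs2 hK.le)).trans_lt ?_
      rw [mul_div_assoc', div_lt_div_iff_of_pos_right ht]
      nlinarith [mul_pos hK hu]
    obtain ⟨t', ht', hlt⟩ := exists_lt_of_orliczDualInv_lt h₁ hu.le hs1
    have hM := h₁.nonneg ht'.le
    have hq : 3 * K * (l / n) / t * t' = (l / n) * (3 * K * t' / t) := by ring
    rw [hq] at hlt
    have hc : 1 ≤ 3 * K * t' / t := by
      by_contra! hc
      nlinarith
    have h3 : (3 * K)⁻¹ * t = (3 * K * t' / t)⁻¹ * t' := by field_simp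
    rw [h3]
    refine (h₁.map_mul_le (by positivity) (inv_le_one_of_one_le₀ hc) ht'.le).trans ?_
    rw [inv_mul_le_iff₀ (by positivity)]
    have : 3 * K * t' / t * (l / n) ≤ 3 * K * t' / t * (M₂ t + 1 / n) := by gcongr
    linarith
  rw [← div_le_iff₀' (by positivity)]
  refine le_orliczNorm h₂ fun ρ hρ hsum => ?_
  rw [div_le_iff₀' (by positivity)]
  refine orliczNorm_le (by positivity) ?_
  have hnn : ∀ i, 0 ≤ |x i| / ρ := fun i => by positivity
  -- The `n` rounding errors add up to at most 1; the extra factor 2 in `6K` absorbs them by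
  -- convexity.
  calc ∑ i, M₁ (|x i| / (6 * K * ρ)) ≤ ∑ i, (1 / 2 : ℝ) * (M₂ (|x i| / ρ) + 1 / n) := by
        refine Finset.sum_le_sum fun i _ => ?_
        have e : |x i| / (6 * K * ρ) = (1 / 2) * ((3 * K)⁻¹ * (|x i| / ρ)) := by
          field_simp; ring
        rw [e]
        refine (h₁.map_mul_le (by norm_num) (by norm_num) (by positivity)).trans ?_
        refine mul_le_mul_of_nonneg_left (key _ (hnn i) ?_ (Fin.pos i)) (by norm_num)
        exact (Finset.single_le_sum (f := fun i => M₂ (|x i| / ρ))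
          (fun i _ => h₂.nonneg (hnn i)) (Finset.mem_univ i)).trans hsum
    _ = (1 / 2 : ℝ) * (∑ i, M₂ (|x i| / ρ) + n * (1 / n)) := by
        rw [← Finset.mul_sum, Finset.sum_add_distrib]; simp
    _ ≤ (1 / 2 : ℝ) * (1 + 1) := by
        gcongr
        rcases n.eq_zero_or_pos with rfl | hn
        · simp
        · rw [mul_one_div_cancel (by positivity)]
    _ = 1 := by norm_num

end Norm

/-! ### The function `t ↦ t ^ s`, continued linearly beyond `1` -/

/-- `t ^ s` for `t ≤ 1`, continued by its tangent for `t > 1`. -/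
def linPow (s t : ℝ) : ℝ := if t ≤ 1 then t ^ s else s * t - (s - 1)

section LinPow

variable {s t : ℝ}

theorem tangent_le_rpow {a : ℝ} (hs : 1 < s) (ha : 0 ≤ a) (ht : 0 ≤ t) :
    s * a ^ (s - 1) * t - (s - 1) * a ^ s ≤ t ^ s := by
  rcases ha.eq_or_lt with rfl | ha
  · rw [Real.zero_rpow (by linarith), Real.zero_rpow (by linarith)]
    simpa using Real.rpow_nonneg ht s
  · have h := one_add_mul_self_le_rpow_one_add (s := t / a - 1) (by
      have : 0 ≤ t / a := by positivity
      linarith) hs.le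
    rw [add_sub_cancel, Real.div_rpow ht ha.le, le_div_iff₀ (by positivity)] at h
    refine le_trans (le_of_eq ?_) h
    have e : a ^ s = a ^ (s - 1) * a := by
      rw [Real.rpow_sub_one ha.ne', div_mul_cancel₀ _ ha.ne']
    rw [e]
    field_simp
    ring

theorem linPow_le_rpow (hs : 1 < s) (ht : 0 ≤ t) : linPow s t ≤ t ^ s := by
  unfold linPow
  split_ifs
  · exact le_rfl
  · simpa using tangent_le_rpow hs zero_le_one ht

theorem linPow_nonneg (hs : 1 < s) (ht : 0 ≤ t) : 0 ≤ linPow s t := by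
  unfold linPow
  split_ifs
  · positivity
  · nlinarith

theorem linPow_pos (hs : 1 < s) (ht : 0 < t) : 0 < linPow s t := by
  unfold linPow
  split_ifs
  · positivity
  · nlinarith

theorem linPow_zero (hs : 1 < s) : linPow s 0 = 0 := by
  simp [linPow, Real.zero_rpow (by linarith : s ≠ 0)]

theorem linPow_le_mul (hs : 1 < s) (ht : 0 ≤ t) : linPow s t ≤ s * t := by
  unfold linPow
  split_ifs with h
  · have := Real.rpow_le_rpow_of_exponent_ge' ht h zero_le_one hs.le
    rw [Real.rpow_one] at this
    nlinarith
  · linarith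

theorem self_le_linPow (hs : 1 < s) (ht : 1 ≤ t) : t ≤ linPow s t := by
  unfold linPow
  split_ifs with h
  · rw [le_antisymm h ht, Real.one_rpow]
  · nlinarith

theorem self_le_one_add_linPow (hs : 1 < s) (ht : 0 ≤ t) : t ≤ 1 + linPow s t := by
  rcases le_total t 1 with h | h
  · linarith [linPow_nonneg hs ht]
  · linarith [self_le_linPow hs h]

theorem rpow_le_mul_linPow {c : ℝ} (hs : 1 < s) (ht : 0 ≤ t) (hc : 1 ≤ c) (htc : t ≤ c) :
    t ^ s ≤ c ^ (s - 1) * linPow s t := by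
  rcases le_or_gt t 1 with h | h
  · have : linPow s t = t ^ s := if_pos h
    rw [this]
    exact le_mul_of_one_le_left (by positivity) (Real.one_le_rpow hc (by linarith))
  · have e : t ^ s = t ^ (s - 1) * t := by
      rw [Real.rpow_sub_one (by linarith), div_mul_cancel₀ _ (by linarith)]
    rw [e]
    have h1 : t ^ (s - 1) ≤ c ^ (s - 1) := Real.rpow_le_rpow ht htc (by linarith)
    have h2 := self_le_linPow hs h.le
    gcongr

/-- There is a supporting line at every point. A tangent at `a ≤ 1` stays below the linear branch
because it does so at `1` and its slope is at most `s`. -/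
theorem convexOn_linPow (hs : 1 < s) : ConvexOn ℝ (Set.Ici 0) (linPow s) := by
  have key : ∀ a t : ℝ, 0 ≤ a → a ≤ 1 → 0 ≤ t →
      s * a ^ (s - 1) * t - (s - 1) * a ^ s ≤ linPow s t := by
    intro a t ha ha1 ht
    unfold linPow
    split_ifs with h
    · exact tangent_le_rpow hs ha ht
    · have h1 := tangent_le_rpow hs ha zero_le_one
      rw [Real.one_rpow] at h1
      have h2 : a ^ (s - 1) ≤ 1 := Real.rpow_le_one ha ha1 (by linarith)
      nlinarith [mul_nonneg (mul_nonneg (by linarith : 0 ≤ s) (sub_nonneg.2 h2))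
        (by linarith : 0 ≤ t - 1)]
  have key' : ∀ t : ℝ, 0 ≤ t → ∃ c d : ℝ, linPow s t = c * t - d ∧
      ∀ t', 0 ≤ t' → c * t' - d ≤ linPow s t' := by
    intro t ht
    rcases le_total t 1 with h | h
    · refine ⟨s * t ^ (s - 1), (s - 1) * t ^ s, ?_, fun t' ht' => key t t' ht h ht'⟩
      rw [linPow, if_pos h]
      have e : t ^ s = t ^ (s - 1) * t := by
        rcases ht.eq_or_lt with rfl | ht
        · rw [Real.zero_rpow (by linarith), mul_zero]
        · rw [Real.rpow_sub_one ht.ne', div_mul_cancel₀ _ ht.ne']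
      rw [e]; ring
    · refine ⟨s, s - 1, ?_, fun t' ht' => by simpa using key 1 t' zero_le_one le_rfl ht'⟩
      rcases h.eq_or_lt with rfl | h
      · simp [linPow]
      · rw [linPow, if_neg h.not_ge]
  refine ⟨convex_Ici 0, fun x hx y hy a b ha hb hab => ?_⟩
  have hx' : 0 ≤ x := hx
  have hy' : 0 ≤ y := hy
  obtain ⟨c, d, h1, h2⟩ := key' (a * x + b * y) (by positivity)
  simp only [smul_eq_mul]
  rw [h1]
  have := mul_le_mul_of_nonneg_left (h2 x hx') ha
  have := mul_le_mul_of_nonneg_left (h2 y hy') hb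
  have hd : d = a * d + b * d := by rw [← add_mul, hab, one_mul]
  linarith

end LinPow

/-- The Orlicz function `t ↦ (1/n) ∑ k, linPow s (t * w k)`. -/
def avgOrlicz {n : ℕ} (s : ℝ) (w : Fin n → ℝ) (t : ℝ) : ℝ :=
  (1 / (n : ℝ)) * ∑ k, linPow s (t * w k)

theorem isOrlicz_avgOrlicz {n : ℕ} {s : ℝ} (hs : 1 < s) {w : Fin n → ℝ} (hw : ∀ k, 0 ≤ w k)
    (hw0 : w ≠ 0) : IsOrlicz (avgOrlicz s w) where
  convexOn := by
    refine ⟨convex_Ici 0, fun x hx y hy a b ha hb hab => ?_⟩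
    have hx' : 0 ≤ x := hx
    have hy' : 0 ≤ y := hy
    have h : ∑ k, linPow s ((a * x + b * y) * w k) ≤
        a * ∑ k, linPow s (x * w k) + b * ∑ k, linPow s (y * w k) := by
      rw [Finset.mul_sum, Finset.mul_sum, ← Finset.sum_add_distrib]
      refine Finset.sum_le_sum fun k _ => ?_
      have := (convexOn_linPow hs).2 (x := x * w k) (y := y * w k)
        (Set.mem_Ici.2 (mul_nonneg hx' (hw k))) (Set.mem_Ici.2 (mul_nonneg hy' (hw k))) ha hb hab
      simp only [smul_eq_mul] at this
      rwa [add_mul, mul_assoc, mul_assoc]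
    have hn : (0 : ℝ) ≤ 1 / n := by positivity
    have := mul_le_mul_of_nonneg_left h hn
    simp only [avgOrlicz, smul_eq_mul]
    linarith
  map_zero := by simp [avgOrlicz, linPow_zero hs]
  pos t ht := by
    obtain ⟨k, hk⟩ := Function.ne_iff.1 hw0
    have hk' : 0 < w k := lt_of_le_of_ne (hw k) (Ne.symm hk)
    have hn : (0 : ℝ) < n := by exact_mod_cast Fin.pos k
    refine mul_pos (by positivity) (Finset.sum_pos' (fun i _ => linPow_nonneg hs
      (mul_nonneg ht.le (hw i))) ⟨k, Finset.mem_univ k, linPow_pos hs (mul_pos ht hk')⟩)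

/-! ### The averaged Orlicz function satisfies (1) -/

section Target

variable {n : ℕ} {p : ℝ} {y : Fin n → ℝ} {l : ℕ}

theorem card_filter_val_lt (hl : l ≤ n) :
    (Finset.univ.filter (fun i : Fin n => (i : ℕ) < l)).card = l := by
  rw [Fin.card_filter_val_lt, min_eq_right hl]

theorem targetFun_pos (hy0 : y ≠ 0) (hy : Antitone y) (hy1 : ∀ i, 0 ≤ y i) (hl : 1 ≤ l) :
    0 < targetFun p y l := by
  obtain ⟨k, hk⟩ := Function.ne_iff.1 hy0
  have hn : 0 < n := Fin.pos k
  have hn' : (0 : ℝ) < n := by exact_mod_cast hn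
  have hk' : 0 < y ⟨0, hn⟩ :=
    (lt_of_le_of_ne (hy1 k) (Ne.symm hk)).trans_le (hy (Fin.mk_le_of_le_val (Nat.zero_le _)))
  refine add_pos_of_pos_of_nonneg (mul_pos (by positivity) (Finset.sum_pos' (fun i _ => hy1 i)
    ⟨⟨0, hn⟩, by simpa using Nat.pos_of_ne_zero (by omega), hk'⟩)) (mul_nonneg ?_ ?_)
  · positivity
  · exact Real.rpow_nonneg (mul_nonneg (by positivity)
      (Finset.sum_nonneg fun i _ => by positivity)) _

theorem sum_split (f : Fin n → ℝ) : ∑ i ∈ Finset.univ.filter (fun i : Fin n => (i : ℕ) < l), f i +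
    ∑ i ∈ Finset.univ.filter (fun i : Fin n => l ≤ (i : ℕ)), f i = ∑ i, f i := by
  simpa only [not_lt] using
    Finset.sum_filter_add_sum_filter_not Finset.univ (fun i : Fin n => (i : ℕ) < l) f

/-- The weighted geometric mean is bounded by the sum. -/
theorem rpow_mul_rpow_le_add {a b θ : ℝ} (ha : 0 ≤ a) (hb : 0 ≤ b) (h0 : 0 ≤ θ) (h1 : θ ≤ 1) :
    a ^ (1 - θ) * b ^ θ ≤ a + b := by
  have := Real.geom_mean_le_arith_mean2_weighted (sub_nonneg.2 h1) h0 ha hb (by ring)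
  nlinarith

/-- This makes `targetFun p y l / 3` an admissible slope in the definition of `M*⁻¹ (l/n)`, hence a
lower bound for it. -/
theorem targetFun_mul_le (hp : 1 < p) (hy : Antitone y) (hy1 : ∀ i, 0 ≤ y i)
    (hl : 1 ≤ l) (hln : l ≤ n) {t : ℝ} (ht : 0 ≤ t) :
    targetFun p y l * t ≤ 3 * (avgOrlicz p y t + l / n) := by
  have hn' : (0 : ℝ) < n := by exact_mod_cast (hl.trans hln)
  have hl' : (0 : ℝ) < l := by exact_mod_cast hl
  set s₁ := Finset.univ.filter (fun i : Fin n => (i : ℕ) < l)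
  set s₂ := Finset.univ.filter (fun i : Fin n => l ≤ (i : ℕ))
  set M := avgOrlicz p y t with hM
  have hφ : ∀ i, 0 ≤ linPow p (t * y i) := fun i => linPow_nonneg hp (mul_nonneg ht (hy1 i))
  have hM0 : 0 ≤ M := mul_nonneg (by positivity) (Finset.sum_nonneg fun i _ => hφ i)
  set P := (1 / (n : ℝ)) * ∑ i ∈ s₁, t * y i with hP
  have hP1 : P ≤ l / n + M := by
    have h1 : ∑ i ∈ s₁, t * y i ≤ ∑ i ∈ s₁, (1 + linPow p (t * y i)) :=
      Finset.sum_le_sum fun i _ => self_le_one_add_linPow hp (mul_nonneg ht (hy1 i))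
    rw [Finset.sum_add_distrib, Finset.sum_const, card_filter_val_lt hln] at h1
    have h2 : ∑ i ∈ s₁, linPow p (t * y i) ≤ ∑ i, linPow p (t * y i) :=
      Finset.sum_le_univ_sum_of_nonneg hφ
    have h3 : ∑ i ∈ s₁, t * y i ≤ l + ∑ i, linPow p (t * y i) := by
      simp only [nsmul_eq_mul, mul_one] at h1
      linarith
    calc P ≤ (1 / (n : ℝ)) * (l + ∑ i, linPow p (t * y i)) :=
        mul_le_mul_of_nonneg_left h3 (by positivity)
      _ = l / n + M := by rw [hM, avgOrlicz]; ring
  have hP0 : 0 ≤ P := mul_nonneg (by positivity) (Finset.sum_nonneg fun i _ =>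
    mul_nonneg ht (hy1 i))
  -- Since `y` decreases, each entry after the first `l` is at most their mean, so `t * y i ≤ P * n
  -- / l`. Adding 1 ensures `c ≥ 1`, as `rpow_le_mul_linPow` requires.
  set c := 1 + P * n / l with hc
  have hc1 : 1 ≤ c := by
    have : 0 ≤ P * n / l := by positivity
    linarith
  have hyc : ∀ i ∈ s₂, t * y i ≤ c := by
    intro i hi
    have hi' : l ≤ (i : ℕ) := by simpa [s₂] using hi
    have h1 : s₁.card • (t * y i) ≤ ∑ k ∈ s₁, t * y k := by
      refine Finset.card_nsmul_le_sum _ _ _ fun k hk => mul_le_mul_of_nonneg_left (hy ?_) ht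
      have : (k : ℕ) < l := by simpa [s₁] using hk
      exact Fin.le_def.2 (by omega)
    rw [card_filter_val_lt hln, nsmul_eq_mul] at h1
    have h2 : P * n / l = (∑ k ∈ s₁, t * y k) / l := by rw [hP]; field_simp
    have h3 : t * y i ≤ P * n / l := by rw [h2, le_div_iff₀ hl']; linarith
    linarith
  set Q := (1 / (n : ℝ)) * ∑ i ∈ s₂, |y i| ^ p with hQ
  have hQ0 : 0 ≤ Q := mul_nonneg (by positivity) (Finset.sum_nonneg fun i _ => by positivity)
  have hQ1 : t ^ p * Q ≤ c ^ (p - 1) * M := by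
    have h1 : ∑ i ∈ s₂, (t * y i) ^ p ≤ ∑ i ∈ s₂, c ^ (p - 1) * linPow p (t * y i) :=
      Finset.sum_le_sum fun i hi =>
        rpow_le_mul_linPow hp (mul_nonneg ht (hy1 i)) hc1 (hyc i hi)
    have h2 : ∑ i ∈ s₂, linPow p (t * y i) ≤ ∑ i, linPow p (t * y i) :=
      Finset.sum_le_univ_sum_of_nonneg hφ
    have h3 : t ^ p * ∑ i ∈ s₂, |y i| ^ p = ∑ i ∈ s₂, (t * y i) ^ p := by
      rw [Finset.mul_sum]
      exact Finset.sum_congr rfl fun i _ => by rw [abs_of_nonneg (hy1 i), Real.mul_rpow ht (hy1 i)]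
    rw [← Finset.mul_sum] at h1
    calc t ^ p * Q = (1 / (n : ℝ)) * (t ^ p * ∑ i ∈ s₂, |y i| ^ p) := by rw [hQ]; ring
      _ ≤ (1 / (n : ℝ)) * (c ^ (p - 1) * ∑ i, linPow p (t * y i)) := by
        rw [h3]
        have : 0 ≤ c ^ (p - 1) := by positivity
        gcongr
        exact h1.trans (mul_le_mul_of_nonneg_left h2 this)
      _ = c ^ (p - 1) * M := by rw [hM, avgOrlicz]; ring
  have hp0 : 0 < p := by linarith
  have hinv : 1 / p ≤ 1 := (div_le_one hp0).2 hp.le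
  have hQ2 : t * Q ^ (1 / p) ≤ c ^ (1 - 1 / p) * M ^ (1 / p) := by
    have h := Real.rpow_le_rpow (by positivity) hQ1 (by positivity : 0 ≤ 1 / p)
    rw [Real.mul_rpow (by positivity) hQ0, Real.mul_rpow (by positivity) hM0, ← Real.rpow_mul ht,
      ← Real.rpow_mul (by linarith)] at h
    rw [mul_one_div_cancel hp0.ne', Real.rpow_one] at h
    convert h using 3
    field_simp
  -- The choice of `c` gives `(l/n) c = l/n + P`; what remains is a weighted geometric mean of `l/n
  -- + P` and `M`.
  have hfin : ((l : ℝ) / n) ^ (1 - 1 / p) * (t * Q ^ (1 / p)) ≤ (l / n + P) + M := by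
    calc ((l : ℝ) / n) ^ (1 - 1 / p) * (t * Q ^ (1 / p))
        ≤ ((l : ℝ) / n) ^ (1 - 1 / p) * (c ^ (1 - 1 / p) * M ^ (1 / p)) := by gcongr
      _ = (l / n + P) ^ (1 - 1 / p) * M ^ (1 / p) := by
        rw [← mul_assoc, ← Real.mul_rpow (by positivity) (by linarith), hc]
        congr 2
        field_simp
      _ ≤ _ := rpow_mul_rpow_le_add (by positivity) hM0 (by positivity) hinv
  have : targetFun p y l * t = P + ((l : ℝ) / n) ^ (1 - 1 / p) * (t * Q ^ (1 / p)) := by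
    rw [targetFun, hP, ← Finset.mul_sum]
    ring
  rw [this]
  linarith

/-- Young's inequality at this `t` bounds `M*⁻¹ (l/n)` from above. The first `l` entries use the
linear bound for `linPow`, the others the power bound; `t` makes each part of `targetFun`, once
scaled, at most `l/n`. -/
theorem avgOrlicz_add_le (hp : 1 < p) (hy1 : ∀ i, 0 ≤ y i) (hl : 1 ≤ l) (hln : l ≤ n)
    (hΦ : 0 < targetFun p y l) :
    avgOrlicz p y (l / n / targetFun p y l) + l / n ≤ (p + 2) * (l / n) := by
  have hn' : (0 : ℝ) < n := by exact_mod_cast (hl.trans hln)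
  have hl' : (0 : ℝ) < l := by exact_mod_cast hl
  set Φ := targetFun p y l with hΦd
  set t := (l : ℝ) / n / Φ with ht
  have ht0 : 0 < t := by positivity
  have hp0 : 0 < p := by linarith
  set s₁ := Finset.univ.filter (fun i : Fin n => (i : ℕ) < l)
  set s₂ := Finset.univ.filter (fun i : Fin n => l ≤ (i : ℕ))
  set P := (1 / (n : ℝ)) * ∑ i ∈ s₁, y i with hP
  set Q := (1 / (n : ℝ)) * ∑ i ∈ s₂, |y i| ^ p with hQ
  have hP0 : 0 ≤ P := mul_nonneg (by positivity) (Finset.sum_nonneg fun i _ => hy1 i)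
  have hQ0 : 0 ≤ Q := mul_nonneg (by positivity) (Finset.sum_nonneg fun i _ => by positivity)
  have hΦe : Φ = P + ((l : ℝ) / n) ^ (1 - 1 / p) * Q ^ (1 / p) := rfl
  have htΦ : t * Φ = l / n := by rw [ht]; field_simp
  have hX : 0 ≤ ((l : ℝ) / n) ^ (1 - 1 / p) * Q ^ (1 / p) := by positivity
  have h1 : t * P ≤ l / n := by
    rw [← htΦ]; gcongr; linarith
  have h2 : t ^ p * Q ≤ l / n := by
    have h3 : ((l : ℝ) / n) ^ (1 - 1 / p) * (t * Q ^ (1 / p)) ≤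
        ((l : ℝ) / n) ^ (1 - 1 / p) * ((l : ℝ) / n) ^ (1 / p) := by
      rw [← Real.rpow_add (by positivity), sub_add_cancel, Real.rpow_one]
      have : t * (((l : ℝ) / n) ^ (1 - 1 / p) * Q ^ (1 / p)) ≤ t * Φ := by gcongr; linarith
      linarith
    have h4 := le_of_mul_le_mul_left h3 (by positivity)
    have h5 := Real.rpow_le_rpow (by positivity) h4 hp0.le
    rwa [Real.mul_rpow ht0.le (by positivity), ← Real.rpow_mul hQ0,
      ← Real.rpow_mul (by positivity), one_div_mul_cancel hp0.ne', Real.rpow_one,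
      Real.rpow_one] at h5
  have h3 : avgOrlicz p y t ≤ p * (t * P) + t ^ p * Q := by
    rw [avgOrlicz, ← sum_split (l := l)]
    have ha : ∑ i ∈ s₁, linPow p (t * y i) ≤ ∑ i ∈ s₁, p * (t * y i) :=
      Finset.sum_le_sum fun i _ => linPow_le_mul hp (mul_nonneg ht0.le (hy1 i))
    have hb : ∑ i ∈ s₂, linPow p (t * y i) ≤ ∑ i ∈ s₂, t ^ p * |y i| ^ p :=
      Finset.sum_le_sum fun i _ => by
        rw [abs_of_nonneg (hy1 i), ← Real.mul_rpow ht0.le (hy1 i)]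
        exact linPow_le_rpow hp (mul_nonneg ht0.le (hy1 i))
    calc (1 / (n : ℝ)) * (∑ i ∈ s₁, linPow p (t * y i) + ∑ i ∈ s₂, linPow p (t * y i))
        ≤ (1 / (n : ℝ)) * (∑ i ∈ s₁, p * (t * y i) + ∑ i ∈ s₂, t ^ p * |y i| ^ p) := by gcongr
      _ = p * (t * P) + t ^ p * Q := by
        rw [hP, hQ, ← Finset.mul_sum, ← Finset.mul_sum, ← Finset.mul_sum]; ring
  nlinarith

theorem isAssociated_avgOrlicz (hp : 1 < p) (hy0 : y ≠ 0) (hy : Antitone y)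
    (hy1 : ∀ i, 0 ≤ y i) : IsAssociated (1 / 3) (p + 2) p y (avgOrlicz p y) := by
  intro l hl hln
  have hM := isOrlicz_avgOrlicz hp hy1 hy0
  have hΦ : 0 < targetFun p y l := targetFun_pos hy0 hy hy1 hl
  have hn' : (0 : ℝ) < n := by exact_mod_cast (hl.trans hln)
  have hl' : (0 : ℝ) < l := by exact_mod_cast hl
  constructor
  · refine le_orliczDualInv (by positivity) fun t ht => ?_
    linarith [targetFun_mul_le hp hy hy1 hl hln ht]
  · have ht : 0 < (l : ℝ) / n / targetFun p y l := by positivity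
    have h1 := (orliczDualInv_mul_le hM (u := (l : ℝ) / n) (by positivity) ht.le).trans
      (avgOrlicz_add_le hp hy1 hl hln hΦ)
    rw [← le_div_iff₀ ht] at h1
    refine h1.trans (le_of_eq ?_)
    field_simp

end Target

/-! ### Averages over permutations -/

/-- The average over all permutations of `Fin n`. -/
def permAvg {n : ℕ} (F : Equiv.Perm (Fin n) → ℝ) : ℝ :=
  (1 / (n.factorial : ℝ)) * ∑ σ, F σ

section PermAvg

variable {n : ℕ} {F G : Equiv.Perm (Fin n) → ℝ}

theorem permAvg_mono (h : ∀ σ, F σ ≤ G σ) : permAvg F ≤ permAvg G :=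
  mul_le_mul_of_nonneg_left (Finset.sum_le_sum fun σ _ => h σ) (by positivity)

theorem permAvg_nonneg (h : ∀ σ, 0 ≤ F σ) : 0 ≤ permAvg F :=
  mul_nonneg (by positivity) (Finset.sum_nonneg fun σ _ => h σ)

theorem permAvg_const (c : ℝ) : permAvg (fun _ : Equiv.Perm (Fin n) => c) = c := by
  have : (n.factorial : ℝ) ≠ 0 := by exact_mod_cast n.factorial_ne_zero
  simp [permAvg, Fintype.card_perm, this]

theorem permAvg_add : permAvg (fun σ => F σ + G σ) = permAvg F + permAvg G := by
  simp only [permAvg, Finset.sum_add_distrib, mul_add]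

theorem permAvg_sub : permAvg (fun σ => F σ - G σ) = permAvg F - permAvg G := by
  simp only [permAvg, Finset.sum_sub_distrib, mul_sub]

theorem permAvg_const_mul (c : ℝ) : permAvg (fun σ => c * F σ) = c * permAvg F := by
  simp only [permAvg, ← Finset.mul_sum]
  ring

theorem permAvg_sum {ι : Type*} (s : Finset ι) (F : ι → Equiv.Perm (Fin n) → ℝ) :
    permAvg (fun σ => ∑ i ∈ s, F i σ) = ∑ i ∈ s, permAvg (F i) := by
  simp only [permAvg, ← Finset.mul_sum]
  rw [Finset.sum_comm]

theorem sum_perm_mul_swap (i j : Fin n) (F : Equiv.Perm (Fin n) → ℝ) :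
    ∑ σ, F (σ * Equiv.swap i j) = ∑ σ, F σ :=
  Equiv.sum_comp (Equiv.mulRight (Equiv.swap i j)) F

theorem permAvg_apply (f : Fin n → ℝ) (i : Fin n) :
    permAvg (fun σ => f (σ i)) = (1 / (n : ℝ)) * ∑ k, f k := by
  have hn : (n : ℝ) ≠ 0 := by exact_mod_cast (Fin.pos i).ne'
  have h1 : ∀ j, permAvg (fun σ => f (σ j)) = permAvg (fun σ => f (σ i)) := fun j => by
    rw [permAvg, permAvg, ← sum_perm_mul_swap i j]
    simp
  have h2 : ∑ j, permAvg (fun σ => f (σ j)) = ∑ k, f k := by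
    rw [← permAvg_sum]
    simp only [fun σ : Equiv.Perm (Fin n) => Equiv.sum_comp σ f, permAvg_const]
  rw [Finset.sum_congr rfl fun j _ => h1 j, Finset.sum_const, Finset.card_univ,
    Fintype.card_fin, nsmul_eq_mul] at h2
  rw [← h2]
  field_simp

/-- The values of a random permutation are negatively correlated. -/
theorem permAvg_mul_le {f g : Fin n → ℝ} (hfg : Monovary f g) {i j : Fin n} (hij : i ≠ j) :
    permAvg (fun σ => f (σ i) * g (σ j)) ≤
      permAvg (fun σ => f (σ i)) * permAvg (fun σ => g (σ j)) := by
  have hn1 : 1 < n := by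
    have h1 := i.2
    have h2 := j.2
    have h3 : (i : ℕ) ≠ j := fun h => hij (Fin.ext h)
    omega
  have hn : (0 : ℝ) < n := by exact_mod_cast (by omega : 0 < n)
  have hn1' : (0 : ℝ) < n - 1 := by
    have : (1 : ℝ) < n := by exact_mod_cast hn1
    linarith
  have h1 : ∀ k ∈ Finset.univ.erase i, permAvg (fun σ => f (σ i) * g (σ k)) =
      permAvg (fun σ => f (σ i) * g (σ j)) := fun k hk => by
    rw [permAvg, permAvg, ← sum_perm_mul_swap j k]
    simp [Equiv.swap_apply_of_ne_of_ne hij (Finset.ne_of_mem_erase hk).symm]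
  -- Sampling without replacement: the values of `g` away from `i` sum to the fixed total minus `g
  -- (σ i)`.
  have h2 : ∑ k ∈ Finset.univ.erase i, permAvg (fun σ => f (σ i) * g (σ k)) =
      permAvg (fun σ => f (σ i)) * ∑ k, g k - permAvg (fun σ => f (σ i) * g (σ i)) := by
    rw [← permAvg_sum, mul_comm, ← permAvg_const_mul, ← permAvg_sub]
    congr 1
    funext σ
    rw [← Finset.mul_sum, ← Equiv.sum_comp σ g, ← Finset.add_sum_erase _ _ (Finset.mem_univ i)]
    ring
  rw [Finset.sum_congr rfl h1, Finset.sum_const, Finset.card_erase_of_mem (Finset.mem_univ i),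
    Finset.card_univ, Fintype.card_fin, nsmul_eq_mul, Nat.cast_sub hn1.le, Nat.cast_one,
    permAvg_apply f i, permAvg_apply (fun k => f k * g k) i] at h2
  -- Chebyshev's sum inequality.
  have h3 : (∑ k, f k) * ∑ k, g k ≤ n * ∑ k, f k * g k := by
    simpa using hfg.sum_mul_sum_le_card_mul_sum
  rw [permAvg_apply f i, permAvg_apply g j]
  refine le_of_mul_le_mul_left ?_ hn1'
  rw [h2]
  have h4 : (1 / (n : ℝ)) * (1 / n) * ((∑ k, f k) * ∑ k, g k) ≤
      (1 / (n : ℝ)) * ∑ k, f k * g k := by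
    calc (1 / (n : ℝ)) * (1 / n) * ((∑ k, f k) * ∑ k, g k)
        ≤ (1 / (n : ℝ)) * (1 / n) * (n * ∑ k, f k * g k) := by gcongr
      _ = _ := by field_simp
  have h5 : ((n : ℝ) - 1) * (1 / n * ∑ k, f k * (1 / n * ∑ k, g k)) =
      1 / n * ∑ k, f k * ∑ k, g k - 1 / n * (1 / n) * ((∑ k, f k) * ∑ k, g k) := by
    simp only [← Finset.sum_mul]
    field_simp
  have h6 : ((n : ℝ) - 1) * ((1 / n * ∑ k, f k) * (1 / n * ∑ k, g k)) =
      (1 / n * ∑ k, f k) * ∑ k, g k - 1 / n * (1 / n) * ((∑ k, f k) * ∑ k, g k) := by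
    field_simp
  rw [h6]
  linarith

/-- The second moment of a sum of negatively correlated `[0,1]`-valued functions. -/
theorem permAvg_sum_sq_le {f : Fin n → Fin n → ℝ} (hf : ∀ j, Antitone (f j))
    (h0 : ∀ j k, 0 ≤ f j k) (h1 : ∀ j k, f j k ≤ 1) :
    permAvg (fun σ => (∑ j, f j (σ j)) ^ 2) ≤
      permAvg (fun σ => ∑ j, f j (σ j)) + permAvg (fun σ => ∑ j, f j (σ j)) ^ 2 := by
  have hm : ∀ i j, Monovary (f i) (f j) := fun i j => (hf i).monovary (hf j)
  have key : ∀ i j, permAvg (fun σ => f i (σ i) * f j (σ j)) ≤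
      permAvg (fun σ => f i (σ i)) * permAvg (fun σ => f j (σ j)) +
        if i = j then permAvg (fun σ => f i (σ i)) else 0 := by
    intro i j
    split_ifs with h
    · subst h
      have h2 : permAvg (fun σ => f i (σ i) * f i (σ i)) ≤ permAvg (fun σ => f i (σ i)) :=
        permAvg_mono fun σ => mul_le_of_le_one_left (h0 _ _) (h1 _ _)
      nlinarith [mul_self_nonneg (permAvg fun σ => f i (σ i))]
    · simpa using permAvg_mul_le (hm i j) h
  have e : (fun σ : Equiv.Perm (Fin n) => (∑ j, f j (σ j)) ^ 2) =
      fun σ => ∑ i, ∑ j, f i (σ i) * f j (σ j) := by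
    funext σ
    rw [sq, Finset.sum_mul_sum]
  rw [e, permAvg_sum, permAvg_sum]
  calc ∑ i, permAvg (fun σ => ∑ j, f i (σ i) * f j (σ j))
      ≤ ∑ i, ∑ j, (permAvg (fun σ => f i (σ i)) * permAvg (fun σ => f j (σ j)) +
        if i = j then permAvg (fun σ => f i (σ i)) else 0) := by
        refine Finset.sum_le_sum fun i _ => ?_
        rw [permAvg_sum]
        exact Finset.sum_le_sum fun j _ => key i j
    _ = _ := by
        simp only [Finset.sum_add_distrib, Finset.sum_ite_eq, Finset.mem_univ, if_true,
          ← Finset.sum_mul_sum, sq]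
        ring

/-- A second-moment argument: `min 1 V` dominates a concave parabola in `V`, whose mean involves
only the first two moments. -/
theorem le_permAvg_min_one_sum {f : Fin n → Fin n → ℝ} (hf : ∀ j, Antitone (f j))
    (h0 : ∀ j k, 0 ≤ f j k) (h1 : ∀ j k, f j k ≤ 1) {v : ℝ}
    (hv : v = permAvg (fun σ => ∑ j, f j (σ j))) :
    3 / 4 * (v / (1 + v)) ≤ permAvg (fun σ => min 1 (∑ j, f j (σ j))) := by
  have hv0 : 0 ≤ v := hv ▸ permAvg_nonneg fun σ => Finset.sum_nonneg fun j _ => h0 _ _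
  have hsq := permAvg_sum_sq_le hf h0 h1
  rw [← hv] at hsq
  set κ := 1 / (1 + v) with hκ
  have hκ0 : 0 < κ := by positivity
  have hκ1 : κ ≤ 1 := (div_le_one (by positivity)).2 (by linarith)
  -- The parabola has maximum 1, at `κ V = 2`, and lies below `V` because `κ ≤ 1`. With `κ =
  -- 1/(1+v)` the second-moment bound costs exactly a quarter of the main term.
  have hp : ∀ V : ℝ, 0 ≤ V → κ * V - κ ^ 2 / 4 * V ^ 2 ≤ min 1 V := fun V hV => by
    refine le_min ?_ ?_
    · nlinarith [sq_nonneg (κ * V - 2)]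
    · nlinarith [mul_nonneg (sq_nonneg κ) (sq_nonneg V), mul_nonneg (sub_nonneg.2 hκ1) hV]
  refine le_trans ?_ (permAvg_mono fun σ => hp _ (Finset.sum_nonneg fun j _ => h0 _ _))
  rw [permAvg_sub, permAvg_const_mul, permAvg_const_mul, ← hv]
  have h2 : κ ^ 2 / 4 * permAvg (fun σ => (∑ j, f j (σ j)) ^ 2) ≤ κ ^ 2 / 4 * (v + v ^ 2) := by
    gcongr
  have h3 : κ * (1 + v) = 1 := by rw [hκ]; field_simp
  have h4 : κ ^ 2 / 4 * (v + v ^ 2) = κ * v / 4 := by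
    linear_combination (κ * v / 4) * h3
  have h5 : v / (1 + v) = κ * v := by rw [hκ]; ring
  rw [h5]
  linarith

end PermAvg

/-! ### The `ℓ_s`-norm of nonnegative vectors -/

/-- `(∑ i, t i ^ s) ^ (1/s)`, the `ℓ_s`-norm of a nonnegative vector. -/
def powNorm {ι : Type*} [Fintype ι] (s : ℝ) (t : ι → ℝ) : ℝ := (∑ i, t i ^ s) ^ (1 / s)

section PowNorm

variable {ι : Type*} [Fintype ι] {s : ℝ} {t u : ι → ℝ}

theorem powNorm_nonneg (ht : ∀ i, 0 ≤ t i) : 0 ≤ powNorm s t :=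
  Real.rpow_nonneg (Finset.sum_nonneg fun i _ => Real.rpow_nonneg (ht i) _) _

theorem powNorm_rpow (hs : 0 < s) (ht : ∀ i, 0 ≤ t i) : powNorm s t ^ s = ∑ i, t i ^ s := by
  rw [powNorm, ← Real.rpow_mul (Finset.sum_nonneg fun i _ => Real.rpow_nonneg (ht i) _),
    one_div_mul_cancel hs.ne', Real.rpow_one]

theorem powNorm_mono (hs : 0 < s) (ht : ∀ i, 0 ≤ t i) (h : ∀ i, t i ≤ u i) :
    powNorm s t ≤ powNorm s u :=
  Real.rpow_le_rpow (Finset.sum_nonneg fun i _ => Real.rpow_nonneg (ht i) _)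
    (Finset.sum_le_sum fun i _ => Real.rpow_le_rpow (ht i) (h i) hs.le) (by positivity)

theorem powNorm_mul (hs : 0 < s) {c : ℝ} (hc : 0 ≤ c) (ht : ∀ i, 0 ≤ t i) :
    powNorm s (fun i => c * t i) = c * powNorm s t := by
  have h : ∑ i, (c * t i) ^ s = c ^ s * ∑ i, t i ^ s := by
    rw [Finset.mul_sum]
    exact Finset.sum_congr rfl fun i _ => Real.mul_rpow hc (ht i)
  rw [powNorm, h, Real.mul_rpow (by positivity)
    (Finset.sum_nonneg fun i _ => Real.rpow_nonneg (ht i) _), ← Real.rpow_mul hc,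
    mul_one_div_cancel hs.ne', Real.rpow_one, powNorm]

theorem le_powNorm (hs : 0 < s) (ht : ∀ i, 0 ≤ t i) (i : ι) : t i ≤ powNorm s t := by
  have h := Real.rpow_le_rpow (Real.rpow_nonneg (ht i) s) (Finset.single_le_sum
    (f := fun i => t i ^ s) (fun i _ => Real.rpow_nonneg (ht i) s) (Finset.mem_univ i))
    (by positivity : 0 ≤ 1 / s)
  rwa [← Real.rpow_mul (ht i), mul_one_div_cancel hs.ne', Real.rpow_one] at h

/-- Entries are added one at a time to a base `x ≥ 1`. There `x ↦ x ^ s` has slope at least 1, so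
raising `x` by `a ^ s` pays for a small entry `a`; a large entry is paid for by superadditivity of
the power. -/
theorem powNorm_le_one_add (hs : 1 < s) (ht : ∀ i, 0 ≤ t i) :
    powNorm s t ≤ 1 + ∑ i, linPow s (t i) := by
  classical
  have hs0 : 0 < s := by linarith
  have step : ∀ x a : ℝ, 1 ≤ x → 0 ≤ a → x ^ s + a ^ s ≤ (x + linPow s a) ^ s := by
    intro x a hx ha
    have hx0 : 0 < x := by linarith
    rcases le_total 1 a with h | h
    · have h1 : x ^ s + a ^ s ≤ (x + a) ^ s := Real.add_rpow_le_rpow_add hx0.le ha hs.le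
      exact h1.trans (Real.rpow_le_rpow (by positivity)
        (by linarith [self_le_linPow hs h]) hs0.le)
    · have e : linPow s a = a ^ s := if_pos h
      rw [e]
      have h1 := tangent_le_rpow (t := x + a ^ s) hs hx0.le (by positivity)
      have h2 : x ^ s = x ^ (s - 1) * x := by
        rw [Real.rpow_sub_one hx0.ne', div_mul_cancel₀ _ hx0.ne']
      have h3 : 1 ≤ x ^ (s - 1) := Real.one_le_rpow hx (by linarith)
      have h4 : s * x ^ (s - 1) * (x + a ^ s) - (s - 1) * x ^ s =
          x ^ s + s * x ^ (s - 1) * a ^ s := by rw [h2]; ring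
      rw [h4] at h1
      have h5 : 1 * a ^ s ≤ s * x ^ (s - 1) * a ^ s := by
        gcongr
        nlinarith
      linarith
  have key : ∀ S : Finset ι, 1 + ∑ i ∈ S, t i ^ s ≤ (1 + ∑ i ∈ S, linPow s (t i)) ^ s := by
    intro S
    induction S using Finset.induction_on with
    | empty => simp
    | insert i S hi ih =>
      rw [Finset.sum_insert hi, Finset.sum_insert hi]
      have h0 : 0 ≤ ∑ i ∈ S, linPow s (t i) :=
        Finset.sum_nonneg fun i _ => linPow_nonneg hs (ht i)
      have := step (1 + ∑ i ∈ S, linPow s (t i)) (t i) (by linarith) (ht i)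
      rw [show 1 + (linPow s (t i) + ∑ i ∈ S, linPow s (t i)) =
        1 + ∑ i ∈ S, linPow s (t i) + linPow s (t i) by ring]
      linarith
  have h0 : 0 ≤ ∑ i, linPow s (t i) := Finset.sum_nonneg fun i _ => linPow_nonneg hs (ht i)
  have hnn : 0 ≤ ∑ i, t i ^ s := Finset.sum_nonneg fun i _ => Real.rpow_nonneg (ht i) _
  have h := Real.rpow_le_rpow hnn
    ((by linarith : ∑ i, t i ^ s ≤ 1 + ∑ i, t i ^ s).trans (key Finset.univ))
    (by positivity : 0 ≤ 1 / s)
  rwa [← Real.rpow_mul (by positivity), mul_one_div_cancel hs0.ne', Real.rpow_one] at h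

end PowNorm

/-! ### Averages of `ℓ_s`-norms over permutations -/

section Average

variable {n : ℕ} {s : ℝ} {w u : Fin n → ℝ}

theorem permAvg_linPow (j : Fin n) :
    permAvg (fun σ => linPow s (u j * w (σ j))) = avgOrlicz s w (u j) :=
  permAvg_apply (fun k => linPow s (u j * w k)) j

theorem permAvg_powNorm_le_two (hs : 1 < s) (hw : ∀ k, 0 ≤ w k) (hu : ∀ k, 0 ≤ u k)
    (h : ∑ j, avgOrlicz s w (u j) ≤ 1) :
    permAvg (fun σ => powNorm s (fun j => u j * w (σ j))) ≤ 2 := by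
  refine (permAvg_mono fun σ => powNorm_le_one_add hs fun j => mul_nonneg (hu j) (hw _)).trans ?_
  rw [permAvg_add, permAvg_const, permAvg_sum]
  simp only [permAvg_linPow]
  linarith

theorem le_permAvg_powNorm (hs : 1 < s) (hwa : Antitone w) (hw : ∀ k, 0 ≤ w k)
    (hu : ∀ k, 0 ≤ u k) (h : 1 ≤ ∑ j, avgOrlicz s w (u j)) :
    3 / (20 * s) ≤ permAvg (fun σ => powNorm s (fun j => u j * w (σ j))) := by
  have hs0 : 0 < s := by linarith
  have hξ : ∀ j k, 0 ≤ u j * w k := fun j k => mul_nonneg (hu j) (hw k)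
  have hξa : ∀ j, Antitone fun k => u j * w k := fun j k l hkl =>
    mul_le_mul_of_nonneg_left (hwa hkl) (hu j)
  set V : Fin n → Fin n → ℝ := fun j k => min ((u j * w k) ^ s) 1 with hV
  set f : Fin n → Fin n → ℝ := fun j k => if 1 < u j * w k then u j * w k else 0 with hf
  set g : Fin n → Fin n → ℝ := fun j k => if 1 < u j * w k then 1 else 0 with hg
  have hV0 : ∀ j k, 0 ≤ V j k := fun j k => le_min (Real.rpow_nonneg (hξ j k) _) zero_le_one
  have hV1 : ∀ j k, V j k ≤ 1 := fun j k => min_le_right _ _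
  have hVa : ∀ j, Antitone (V j) := fun j k l hkl =>
    min_le_min_right _ (Real.rpow_le_rpow (hξ j l) (hξa j hkl) hs0.le)
  have hg0 : ∀ j k, 0 ≤ g j k := fun j k => by simp only [hg]; split_ifs <;> norm_num
  have hf0 : ∀ j k, 0 ≤ f j k := fun j k => by
    simp only [hf]; split_ifs; exacts [hξ j k, le_rfl]
  have hfa : ∀ j, Antitone (f j) := fun j k l hkl => by
    have h1 := hξa j hkl
    simp only [hf] at h1 ⊢
    split_ifs with h2 h3 h3
    · exact h1
    · exact absurd (h2.trans_le h1) h3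
    · exact hξ j k
    · exact le_rfl
  have hga : ∀ j, Antitone (g j) := fun j k l hkl => by
    have h1 := hξa j hkl
    simp only [hg] at h1 ⊢
    split_ifs with h2 h3 h3
    · exact le_rfl
    · exact absurd (h2.trans_le h1) h3
    · exact zero_le_one
    · exact le_rfl
  set v := permAvg (fun σ => ∑ j, V j (σ j)) with hv
  have hv0 : 0 ≤ v := permAvg_nonneg fun σ => Finset.sum_nonneg fun j _ => hV0 _ _
  -- If the truncated `s`-th powers have substantial mean, the second-moment bound suffices.
  -- Otherwise entries above 1 are rare and carry most of the mass.
  rcases le_or_gt (1 / 4) v with hv4 | hv4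
  · have h1 := le_permAvg_min_one_sum hVa hV0 hV1 hv
    have h2 : permAvg (fun σ => min 1 (∑ j, V j (σ j))) ≤
        permAvg (fun σ => powNorm s (fun j => u j * w (σ j))) := permAvg_mono fun σ => by
      set S := ∑ j, (u j * w (σ j)) ^ s with hS
      have hVS : ∑ j, V j (σ j) ≤ S := Finset.sum_le_sum fun j _ => min_le_left _ _
      change _ ≤ S ^ (1 / s)
      have hS0 : 0 ≤ S := Finset.sum_nonneg fun j _ => Real.rpow_nonneg (hξ _ _) _
      rcases le_total 1 S with hS1 | hS1
      · exact (min_le_left _ _).trans (Real.one_le_rpow hS1 (by positivity))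
      · refine (min_le_right _ _).trans (hVS.trans ?_)
        have := Real.rpow_le_rpow_of_exponent_ge' hS0 hS1 (by positivity : 0 ≤ 1 / s)
          ((div_le_one hs0).2 hs.le)
        rwa [Real.rpow_one] at this
    refine le_trans ?_ (h1.trans h2)
    have h3 : 1 / 5 ≤ v / (1 + v) := by
      rw [div_le_div_iff₀ (by norm_num) (by positivity)]; linarith
    have h4 : 3 / (20 * s) ≤ 3 / 20 := by
      apply div_le_div_of_nonneg_left <;> linarith
    linarith
  · set β := ∑ j, permAvg (fun σ => f j (σ j)) with hβ
    set μ := ∑ j, permAvg (fun σ => g j (σ j)) with hμ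
    have hβ0 : 0 ≤ β := Finset.sum_nonneg fun j _ => permAvg_nonneg fun σ => hf0 _ _
    have hμv : μ ≤ v := by
      rw [hμ, hv, ← permAvg_sum]
      refine permAvg_mono fun σ => Finset.sum_le_sum fun j _ => ?_
      simp only [hg, hV]
      split_ifs with h1
      · exact le_min (Real.one_le_rpow h1.le hs0.le) le_rfl
      · exact hV0 j (σ j)
    have hsum : 1 ≤ v + s * β := by
      refine h.trans ?_
      rw [hv, hβ, permAvg_sum, Finset.mul_sum, ← Finset.sum_add_distrib]
      refine Finset.sum_le_sum fun j _ => ?_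
      rw [← permAvg_linPow j, ← permAvg_const_mul, ← permAvg_add]
      refine permAvg_mono fun σ => ?_
      simp only [hf, hV]
      split_ifs with h1
      · have := linPow_le_mul hs (hξ j (σ j))
        have := hV0 j (σ j)
        simp only [hV] at this
        linarith
      · have : linPow s (u j * w (σ j)) = (u j * w (σ j)) ^ s := if_pos (not_lt.1 h1)
        rw [this, min_eq_left (Real.rpow_le_one (hξ _ _) (not_lt.1 h1) hs0.le)]
        simp
    -- An entry counts only when it is the sole one above 1. If there are several, every summand is
    -- nonpositive except possibly one, and that one is at most a single entry.
    have hmain : ∀ σ : Equiv.Perm (Fin n),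
        ∑ j, (f j (σ j) - ∑ k ∈ Finset.univ.erase j, f j (σ j) * g k (σ k)) ≤
          powNorm s (fun j => u j * w (σ j)) := by
      intro σ
      have hN := powNorm_nonneg (s := s) fun j => hξ j (σ j)
      by_cases hex : ∃ j, 1 < u j * w (σ j)
      · obtain ⟨j, hj⟩ := hex
        rw [← Finset.add_sum_erase _ _ (Finset.mem_univ j)]
        have h1 : ∑ k ∈ Finset.univ.erase j,
            (f k (σ k) - ∑ l ∈ Finset.univ.erase k, f k (σ k) * g l (σ l)) ≤ 0 := by
          refine Finset.sum_nonpos fun k hk => ?_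
          have hjk : j ∈ Finset.univ.erase k := by simpa using (Finset.ne_of_mem_erase hk).symm
          have h2 := Finset.single_le_sum (f := fun l => f k (σ k) * g l (σ l))
            (fun l _ => mul_nonneg (hf0 _ _) (hg0 _ _)) hjk
          have h3 : g j (σ j) = 1 := if_pos hj
          simp only [h3, mul_one] at h2
          linarith
        have h2 : 0 ≤ ∑ l ∈ Finset.univ.erase j, f j (σ j) * g l (σ l) :=
          Finset.sum_nonneg fun l _ => mul_nonneg (hf0 _ _) (hg0 _ _)
        have h3 : f j (σ j) = u j * w (σ j) := if_pos hj
        have h4 := le_powNorm hs0 (fun j => hξ j (σ j)) j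
        linarith
      · push Not at hex
        refine le_trans (le_of_eq (Finset.sum_eq_zero fun j _ => ?_)) hN
        have h3 : f j (σ j) = 0 := if_neg (hex j).not_gt
        simp [h3]
    have hfin : β * (1 - μ) ≤ permAvg (fun σ => powNorm s (fun j => u j * w (σ j))) := by
      refine le_trans ?_ (permAvg_mono hmain)
      rw [permAvg_sum, hβ, Finset.sum_mul]
      refine Finset.sum_le_sum fun j _ => ?_
      rw [permAvg_sub, permAvg_sum, mul_sub, mul_one]
      refine sub_le_sub_left ?_ _
      calc ∑ k ∈ Finset.univ.erase j, permAvg (fun σ => f j (σ j) * g k (σ k))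
          ≤ ∑ k ∈ Finset.univ.erase j,
            permAvg (fun σ => f j (σ j)) * permAvg (fun σ => g k (σ k)) :=
            Finset.sum_le_sum fun k hk => permAvg_mul_le ((hfa j).monovary (hga k))
              (Finset.ne_of_mem_erase hk).symm
        _ = permAvg (fun σ => f j (σ j)) *
            ∑ k ∈ Finset.univ.erase j, permAvg (fun σ => g k (σ k)) := by rw [Finset.mul_sum]
        _ ≤ permAvg (fun σ => f j (σ j)) * μ :=
            mul_le_mul_of_nonneg_left (Finset.sum_le_univ_sum_of_nonneg fun k =>
              permAvg_nonneg fun σ => hg0 _ _) (permAvg_nonneg fun σ => hf0 _ _)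
    refine le_trans ?_ hfin
    rw [div_le_iff₀ (by positivity)]
    nlinarith [mul_nonneg hβ0 hs0.le]

/-- The average over permutations of the `ℓ_s`-norms of `(u j * w (σ j))_j` is an Orlicz norm. -/
theorem permAvg_powNorm_le_orliczNorm (hs : 1 < s) (hw : ∀ k, 0 ≤ w k) (hw0 : w ≠ 0)
    (hu : ∀ k, 0 ≤ u k) :
    permAvg (fun σ => powNorm s (fun j => u j * w (σ j))) ≤
      2 * orliczNorm (avgOrlicz s w) u := by
  have hs0 : 0 < s := by linarith
  rw [← div_le_iff₀' (by norm_num)]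
  refine le_orliczNorm (isOrlicz_avgOrlicz hs hw hw0) fun ρ hρ h => ?_
  simp only [abs_of_nonneg (hu _)] at h
  have h1 := permAvg_powNorm_le_two hs hw (fun k => div_nonneg (hu k) hρ.le) h
  have e : ∀ σ : Equiv.Perm (Fin n), powNorm s (fun j => u j / ρ * w (σ j)) =
      ρ⁻¹ * powNorm s (fun j => u j * w (σ j)) := fun σ => by
    rw [← powNorm_mul hs0 (by positivity) fun j => mul_nonneg (hu j) (hw _)]
    congr 1
    funext j
    ring
  simp only [e] at h1
  rw [permAvg_const_mul, inv_mul_le_iff₀ hρ] at h1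
  linarith

/-- By homogeneity: each positive `ρ` below the norm is infeasible, so `u / ρ` satisfies the
hypothesis of `le_permAvg_powNorm`. -/
theorem orliczNorm_le_permAvg_powNorm (hs : 1 < s) (hwa : Antitone w) (hw : ∀ k, 0 ≤ w k)
    (hu : ∀ k, 0 ≤ u k) :
    3 / (20 * s) * orliczNorm (avgOrlicz s w) u ≤
      permAvg (fun σ => powNorm s (fun j => u j * w (σ j))) := by
  have hs0 : 0 < s := by linarith
  have hc : 0 < 3 / (20 * s) := by positivity
  have hE : 0 ≤ permAvg (fun σ => powNorm s (fun j => u j * w (σ j))) :=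
    permAvg_nonneg fun σ => powNorm_nonneg fun j => mul_nonneg (hu j) (hw _)
  rw [← le_div_iff₀' hc]
  refine le_of_forall_lt_imp_le_of_dense fun ρ hρ' => ?_
  rcases le_or_gt ρ 0 with hρ | hρ
  · exact hρ.trans (by positivity)
  have hgt : 1 < ∑ j, avgOrlicz s w (u j / ρ) := by
    by_contra! hcon
    refine hρ'.not_ge (orliczNorm_le hρ ?_)
    simpa only [abs_of_nonneg (hu _)] using hcon
  have h1 := le_permAvg_powNorm hs hwa hw (fun k => div_nonneg (hu k) hρ.le) hgt.le
  have e : ∀ σ : Equiv.Perm (Fin n), powNorm s (fun j => u j / ρ * w (σ j)) =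
      ρ⁻¹ * powNorm s (fun j => u j * w (σ j)) := fun σ => by
    rw [← powNorm_mul hs0 (by positivity) fun j => mul_nonneg (hu j) (hw _)]
    congr 1
    funext j
    ring
  simp only [e] at h1
  rw [permAvg_const_mul, le_inv_mul_iff₀ hρ] at h1
  rw [le_div_iff₀ hc]
  linarith

end Average

/-! ### The vectors `((n/i)^{1/q})_i` -/

section PowerVec

/-- Bernoulli's inequality. This lemma and the next bound a power at `x + 1` by a difference of
powers, a discrete primitive that makes power sums telescope. -/
theorem rpow_add_mul_rpow_le {x γ : ℝ} (hx : 0 ≤ x) (h0 : 0 ≤ γ) (h1 : γ ≤ 1) :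
    x ^ γ + γ * (x + 1) ^ (γ - 1) ≤ (x + 1) ^ γ := by
  have hx1 : 0 < x + 1 := by linarith
  have h := rpow_one_add_le_one_add_mul_self (s := -1 / (x + 1)) (by
    rw [neg_div, neg_le_neg_iff, div_le_one hx1]; linarith) h0 h1
  have e : 1 + -1 / (x + 1) = x / (x + 1) := by field_simp; ring
  rw [e, Real.div_rpow hx hx1.le, div_le_iff₀ (by positivity)] at h
  have e2 : (x + 1) ^ (γ - 1) = (x + 1) ^ γ / (x + 1) := Real.rpow_sub_one hx1.ne' γ
  rw [e2]
  have e3 : (1 + γ * (-1 / (x + 1))) * (x + 1) ^ γ =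
      (x + 1) ^ γ - γ * ((x + 1) ^ γ / (x + 1)) := by ring
  linarith

theorem rpow_neg_add_mul_rpow_le {x γ : ℝ} (hx : 0 < x) (h0 : 0 ≤ γ) (h1 : γ ≤ 1) :
    (x + 1) ^ (-γ) + γ * (x + 1) ^ (-γ - 1) ≤ x ^ (-γ) := by
  have hx1 : 0 < x + 1 := by linarith
  have h := rpow_add_mul_rpow_le hx.le h0 h1
  rw [Real.rpow_sub_one hx1.ne', Real.rpow_neg hx1.le] at *
  rw [Real.rpow_neg hx.le, le_inv_comm₀ (by positivity) (by positivity)]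
  have hA : 0 < (x + 1) ^ γ := by positivity
  set A := (x + 1) ^ γ
  set d := γ / (x + 1) with hd
  have hd0 : 0 ≤ d := by positivity
  have h2 : x ^ γ ≤ A * (1 - d) := by
    have : γ * (A / (x + 1)) = A * d := by rw [hd]; ring
    linarith
  have e : A⁻¹ + γ * (A⁻¹ / (x + 1)) = A⁻¹ * (1 + d) := by rw [hd]; ring
  rw [e, mul_inv, inv_inv]
  refine h2.trans (mul_le_mul_of_nonneg_left ?_ hA.le)
  rw [← one_div, le_div_iff₀ (by positivity)]
  nlinarith

/-- A sequence dominated by `c (m/k)^α` and by `(m/k)^β`, `α < 1 < β`, has sum `O(m)`. -/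
theorem sum_le_mul_of_le_rpow {c α β m : ℝ} (hc : 0 ≤ c) (hα0 : 0 ≤ α) (hα : α < 1) (hβ : 1 < β)
    (hβ2 : β ≤ 2) (hm : 0 < m) {h : ℕ → ℝ} (h1 : ∀ k, h k ≤ c * (m / (k + 1)) ^ α)
    (h2 : ∀ k, h k ≤ (m / (k + 1)) ^ β) (N : ℕ) :
    ∑ k ∈ Finset.range N, h k ≤ (c / (1 - α) + 1 + 1 / (β - 1)) * m := by
  have hα' : 0 < 1 - α := by linarith
  have hβ' : 0 < β - 1 := by linarith
  have hmm : m ^ α * m ^ (1 - α) = m := by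
    rw [← Real.rpow_add hm, add_sub_cancel, Real.rpow_one]
  have hle : ∀ x : ℝ, m ≤ x → m ^ β * x ^ (-(β - 1)) ≤ m := fun x hx => by
    have h3 : x ^ (-(β - 1)) ≤ m ^ (-(β - 1)) :=
      Real.rpow_le_rpow_of_nonpos hm hx (by linarith)
    calc m ^ β * x ^ (-(β - 1)) ≤ m ^ β * m ^ (-(β - 1)) := by gcongr
      _ = m := by rw [← Real.rpow_add hm]; ring_nf; exact Real.rpow_one m
  -- Up to `m` the bound with exponent `α < 1` is summed from the start; beyond `m` the bound with
  -- `β > 1` is used, and the subtracted term is the part of the tail not yet spent.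
  have key : ∀ N : ℕ, ((N : ℝ) ≤ m → ∑ k ∈ Finset.range N, h k ≤
        c / (1 - α) * (m ^ α * (N : ℝ) ^ (1 - α))) ∧
      (m < N → ∑ k ∈ Finset.range N, h k ≤ (c / (1 - α) + 1 + 1 / (β - 1)) * m -
        1 / (β - 1) * (m ^ β * (N : ℝ) ^ (-(β - 1)))) := by
    intro N
    induction N with
    | zero =>
      refine ⟨fun _ => by simp [Real.zero_rpow hα'.ne'], fun h => ?_⟩
      simp only [Nat.cast_zero] at h
      linarith
    | succ N ih =>
      have hN0 : (0 : ℝ) ≤ N := N.cast_nonneg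
      have hN1 : (0 : ℝ) < (N : ℝ) + 1 := by positivity
      rw [Finset.sum_range_succ, Nat.cast_succ]
      have h1' := h1 N
      have h2' := h2 N
      rw [Real.div_rpow hm.le hN1.le, div_eq_mul_inv, ← Real.rpow_neg hN1.le] at h1' h2'
      constructor
      · intro hN
        have h3 := ih.1 (by linarith)
        have h4 := rpow_add_mul_rpow_le hN0 hα'.le (by linarith : 1 - α ≤ 1)
        rw [show 1 - α - 1 = -α by ring] at h4
        have h5 : c / (1 - α) * (m ^ α * ((N : ℝ) ^ (1 - α) + (1 - α) * ((N : ℝ) + 1) ^ (-α))) ≤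
            c / (1 - α) * (m ^ α * ((N : ℝ) + 1) ^ (1 - α)) := by gcongr
        have h6 : c / (1 - α) * (m ^ α * ((N : ℝ) ^ (1 - α) + (1 - α) * ((N : ℝ) + 1) ^ (-α))) =
            c / (1 - α) * (m ^ α * (N : ℝ) ^ (1 - α)) +
              c * (m ^ α * ((N : ℝ) + 1) ^ (-α)) := by
          field_simp
        linarith
      · intro hN
        rcases le_or_gt (N : ℝ) m with hNm | hNm
        -- The step that crosses `m`. Its single term is at most `m`, which is the `1` in the
        -- constant, and the tail reserve is at most `m / (β - 1)`.
        · have h3 := ih.1 hNm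
          have h4 : (N : ℝ) ^ (1 - α) ≤ m ^ (1 - α) := Real.rpow_le_rpow hN0 hNm hα'.le
          have h5 : c / (1 - α) * (m ^ α * (N : ℝ) ^ (1 - α)) ≤ c / (1 - α) * m := by
            have h6 : m ^ α * (N : ℝ) ^ (1 - α) ≤ m := by
              calc m ^ α * (N : ℝ) ^ (1 - α) ≤ m ^ α * m ^ (1 - α) := by gcongr
                _ = m := hmm
            gcongr
          have h6 := hle _ hN.le
          have h7 : ((N : ℝ) + 1) ^ (-β) ≤ ((N : ℝ) + 1) ^ (-(β - 1)) :=
            Real.rpow_le_rpow_of_exponent_le (by linarith) (by linarith)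
          have h8 : m ^ β * ((N : ℝ) + 1) ^ (-β) ≤ m ^ β * ((N : ℝ) + 1) ^ (-(β - 1)) := by
            gcongr
          have h9 : 1 / (β - 1) * (m ^ β * ((N : ℝ) + 1) ^ (-(β - 1))) ≤ 1 / (β - 1) * m := by
            gcongr
          linarith
        · have h3 := ih.2 hNm
          have h4 := rpow_neg_add_mul_rpow_le (hm.trans hNm) hβ'.le (by linarith : β - 1 ≤ 1)
          rw [show -(β - 1) - 1 = -β by ring] at h4
          have h5 : 1 / (β - 1) * (m ^ β * (((N : ℝ) + 1) ^ (-(β - 1)) +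
              (β - 1) * ((N : ℝ) + 1) ^ (-β))) ≤
              1 / (β - 1) * (m ^ β * (N : ℝ) ^ (-(β - 1))) := by gcongr
          have h6 : 1 / (β - 1) * (m ^ β * (((N : ℝ) + 1) ^ (-(β - 1)) +
              (β - 1) * ((N : ℝ) + 1) ^ (-β))) =
              1 / (β - 1) * (m ^ β * ((N : ℝ) + 1) ^ (-(β - 1))) +
                m ^ β * ((N : ℝ) + 1) ^ (-β) := by
            field_simp
          linarith
  have hD : 0 ≤ 1 / (β - 1) := by positivity
  have hC : 0 ≤ c / (1 - α) := by positivity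
  rcases le_or_gt (N : ℝ) m with hNm | hNm
  · have h3 : (N : ℝ) ^ (1 - α) ≤ m ^ (1 - α) := Real.rpow_le_rpow N.cast_nonneg hNm hα'.le
    have h4 : m ^ α * (N : ℝ) ^ (1 - α) ≤ m := by
      calc m ^ α * (N : ℝ) ^ (1 - α) ≤ m ^ α * m ^ (1 - α) := by gcongr
        _ = m := hmm
    have h5 := mul_le_mul_of_nonneg_left h4 hC
    have h6 := (key N).1 hNm
    nlinarith [mul_nonneg hD hm.le]
  · have h3 := (key N).2 hNm
    have h4 : 0 ≤ 1 / (β - 1) * (m ^ β * (N : ℝ) ^ (-(β - 1))) := by positivity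
    linarith

variable {n : ℕ} {q s : ℝ}

theorem powerVec_nonneg (k : Fin n) : 0 ≤ powerVec n q k := by
  unfold powerVec; positivity

theorem one_le_powerVec (hq : 0 < q) (k : Fin n) : 1 ≤ powerVec n q k := by
  refine Real.one_le_rpow ?_ (by positivity)
  rw [one_le_div (by positivity)]
  exact_mod_cast k.2

theorem powerVec_ne_zero (hn : 0 < n) (hq : 0 < q) : powerVec n q ≠ 0 := fun h => by
  have := one_le_powerVec hq (⟨0, hn⟩ : Fin n)
  rw [h] at this
  simp only [Pi.zero_apply] at this
  linarith

theorem antitone_powerVec (hq : 0 < q) : Antitone (powerVec n q) := fun i j hij => by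
  refine Real.rpow_le_rpow (by positivity) ?_ (by positivity)
  have : (i : ℝ) ≤ (j : ℝ) := by exact_mod_cast hij
  gcongr

theorem mul_powerVec (hq : 0 < q) {t : ℝ} (ht : 0 ≤ t) (k : Fin n) :
    t * powerVec n q k = (n * t ^ q / ((k : ℝ) + 1)) ^ (1 / q) := by
  rw [powerVec, show n * t ^ q / ((k : ℝ) + 1) = t ^ q * (n / ((k : ℝ) + 1)) by ring,
    Real.mul_rpow (by positivity) (by positivity), ← Real.rpow_mul ht,
    mul_one_div_cancel hq.ne', Real.rpow_one]

theorem exists_avgOrlicz_powerVec_le (hq : 1 < q) (hqs : q < s) (hs : s ≤ 2) :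
    ∃ C : ℝ, 0 < C ∧ ∀ (n : ℕ) (t : ℝ), 0 ≤ t → avgOrlicz s (powerVec n q) t ≤ C * t ^ q := by
  have hq0 : 0 < q := by linarith
  have hs1 : 1 < s := by linarith
  have hα : 1 / q < 1 := (div_lt_one hq0).2 hq
  have hβ : 1 < s / q := (one_lt_div hq0).2 hqs
  have hβ2 : s / q ≤ 2 := by rw [div_le_iff₀ hq0]; linarith
  have hα' : 0 < 1 - 1 / q := by linarith
  have hβ' : 0 < s / q - 1 := by linarith
  refine ⟨s / (1 - 1 / q) + 1 + 1 / (s / q - 1), by positivity, fun n t ht => ?_⟩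
  rcases n.eq_zero_or_pos with rfl | hn
  · simp only [avgOrlicz, Finset.univ_eq_empty, Finset.sum_empty, mul_zero]
    positivity
  rcases ht.eq_or_lt with rfl | ht
  · simp [avgOrlicz, linPow_zero hs1, Real.zero_rpow hq0.ne']
  have hn' : (0 : ℝ) < n := by exact_mod_cast hn
  -- With `m = n t^q` the entries are `(m/(k+1))^{1/q}`. The linear and power bounds for `linPow`
  -- give the exponents `1/q < 1 < s/q`.
  have h := sum_le_mul_of_le_rpow (c := s) (m := n * t ^ q)
    (h := fun k => linPow s ((n * t ^ q / ((k : ℝ) + 1)) ^ (1 / q))) (by linarith)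
    (by positivity) hα hβ hβ2 (by positivity)
    (fun k => linPow_le_mul hs1 (by positivity)) (fun k => by
      refine (linPow_le_rpow hs1 (by positivity)).trans (le_of_eq ?_)
      rw [← Real.rpow_mul (by positivity), one_div_mul_eq_div]) n
  rw [Finset.sum_range] at h
  simp only [avgOrlicz, mul_powerVec hq0 ht.le]
  calc _ ≤ (1 / (n : ℝ)) * ((s / (1 - 1 / q) + 1 + 1 / (s / q - 1)) * (n * t ^ q)) :=
        mul_le_mul_of_nonneg_left h (by positivity)
    _ = _ := by field_simp

/-- The first `⌊n t^q⌋` scaled entries are at least 1, and each contributes at least 1; rounding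
costs `1/n`. -/
theorem rpow_sub_le_avgOrlicz_powerVec (hq : 1 < q) (hs : 1 < s) (hn : 0 < n) {t : ℝ}
    (ht : 0 ≤ t) (ht1 : t ≤ 1) : t ^ q - 1 / n ≤ avgOrlicz s (powerVec n q) t := by
  have hq0 : 0 < q := by linarith
  have hn' : (0 : ℝ) < n := by exact_mod_cast hn
  set m := n * t ^ q with hm
  have hm0 : 0 ≤ m := by positivity
  have hmn : m ≤ n := mul_le_of_le_one_right hn'.le (Real.rpow_le_one ht ht1 hq0.le)
  have hK : ⌊m⌋₊ ≤ n := Nat.floor_le_of_le hmn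
  have hsum : (⌊m⌋₊ : ℝ) ≤ ∑ k, linPow s (t * powerVec n q k) := by
    calc (⌊m⌋₊ : ℝ) = ∑ k ∈ Finset.univ.filter (fun i : Fin n => (i : ℕ) < ⌊m⌋₊), (1 : ℝ) := by
          rw [Finset.sum_const, card_filter_val_lt hK, nsmul_eq_mul, mul_one]
      _ ≤ ∑ k ∈ Finset.univ.filter (fun i : Fin n => (i : ℕ) < ⌊m⌋₊),
          linPow s (t * powerVec n q k) := by
        refine Finset.sum_le_sum fun k hk => ?_
        have hk' : (k : ℕ) + 1 ≤ ⌊m⌋₊ := by simpa using hk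
        have hk2 : ((k : ℝ) + 1) ≤ m := by
          have := (Nat.le_floor_iff hm0).1 hk'
          exact_mod_cast this
        have h1 : 1 ≤ t * powerVec n q k := by
          rw [mul_powerVec hq0 ht]
          refine Real.one_le_rpow ?_ (by positivity)
          rwa [one_le_div (by positivity)]
        exact h1.trans (self_le_linPow hs h1)
      _ ≤ _ := Finset.sum_le_univ_sum_of_nonneg fun k =>
        linPow_nonneg hs (mul_nonneg ht (powerVec_nonneg k))
  have h2 := Nat.lt_floor_add_one m
  rw [avgOrlicz, one_div_mul_eq_div, le_div_iff₀ hn', sub_mul, one_div_mul_cancel hn'.ne']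
  linarith

theorem self_le_avgOrlicz (hs : 1 < s) {w : Fin n → ℝ} (hw : ∀ k, 1 ≤ w k) (hn : 0 < n) {t : ℝ}
    (ht : 1 ≤ t) : t ≤ avgOrlicz s w t := by
  have hn' : (0 : ℝ) < n := by exact_mod_cast hn
  have h : ∑ _k : Fin n, t ≤ ∑ k, linPow s (t * w k) := Finset.sum_le_sum fun k _ => by
    have h1 : t ≤ t * w k := le_mul_of_one_le_right (by linarith) (hw k)
    exact h1.trans (self_le_linPow hs (ht.trans h1))
  rw [avgOrlicz, one_div_mul_eq_div, le_div_iff₀ hn']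
  simpa [mul_comm] using h

theorem powNorm_le_orliczNorm_powerVec (hq : 1 < q) (hs : 1 < s) (hn : 0 < n)
    {u : Fin n → ℝ} (hu : ∀ k, 0 ≤ u k) :
    powNorm q u ≤ 2 * orliczNorm (avgOrlicz s (powerVec n q)) u := by
  have hq0 : 0 < q := by linarith
  have hn' : (0 : ℝ) < n := by exact_mod_cast hn
  have hO := isOrlicz_avgOrlicz hs powerVec_nonneg (powerVec_ne_zero (q := q) hn hq0)
  rw [← div_le_iff₀' (by norm_num)]
  refine le_orliczNorm hO fun ρ hρ h => ?_
  simp only [abs_of_nonneg (hu _)] at h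
  have hv : ∀ k, 0 ≤ u k / ρ := fun k => div_nonneg (hu k) hρ.le
  -- The power lower bound is available only on `[0,1]`; a larger coordinate would alone exceed the
  -- budget 1.
  have hv1 : ∀ k, u k / ρ ≤ 1 := fun k => by
    by_contra! hk
    have h1 := self_le_avgOrlicz hs (one_le_powerVec (n := n) hq0) hn hk.le
    have h2 := (Finset.single_le_sum (f := fun k => avgOrlicz s (powerVec n q) (u k / ρ))
      (fun i _ => hO.nonneg (hv i)) (Finset.mem_univ k)).trans h
    linarith
  have h1 : ∑ k, ((u k / ρ) ^ q - 1 / n) ≤ 1 := (Finset.sum_le_sum fun k _ =>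
    rpow_sub_le_avgOrlicz_powerVec hq hs hn (hv k) (hv1 k)).trans h
  rw [Finset.sum_sub_distrib] at h1
  have h2 : ∑ k, (u k / ρ) ^ q ≤ 2 := by
    have : ∑ _k : Fin n, 1 / (n : ℝ) = 1 := by simp [hn'.ne']
    linarith
  have h3 : powNorm q (fun k => u k / ρ) ≤ 2 := by
    refine (Real.rpow_le_rpow (Finset.sum_nonneg fun k _ => Real.rpow_nonneg (hv k) _) h2
      (by positivity)).trans ?_
    have := Real.rpow_le_rpow_of_exponent_le (x := 2) (by norm_num)
      ((div_le_one hq0).2 hq.le)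
    rwa [Real.rpow_one] at this
  have h4 : powNorm q (fun k => u k / ρ) = ρ⁻¹ * powNorm q u := by
    rw [← powNorm_mul hq0 (by positivity) hu]
    simp only [div_eq_inv_mul]
  rw [h4, inv_mul_le_iff₀ hρ] at h3
  linarith

theorem exists_orliczNorm_powerVec_le (hq : 1 < q) (hqs : q < s) (hs : s ≤ 2) :
    ∃ C : ℝ, 0 < C ∧ ∀ (n : ℕ) (u : Fin n → ℝ), (∀ k, 0 ≤ u k) →
      orliczNorm (avgOrlicz s (powerVec n q)) u ≤ C * powNorm q u := by
  have hq0 : 0 < q := by linarith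
  obtain ⟨C, hC, h⟩ := exists_avgOrlicz_powerVec_le hq hqs hs
  refine ⟨C ^ (1 / q), by positivity, fun n u hu => ?_⟩
  refine le_of_forall_gt_imp_ge_of_dense fun ρ hρ' => ?_
  have hT := powNorm_nonneg (s := q) hu
  have hρ : 0 < ρ := (by positivity : 0 ≤ C ^ (1 / q) * powNorm q u).trans_lt hρ'
  refine orliczNorm_le hρ ?_
  simp only [abs_of_nonneg (hu _)]
  refine (Finset.sum_le_sum fun k _ => h n _ (div_nonneg (hu k) hρ.le)).trans ?_
  simp only [Real.div_rpow (hu _) hρ.le]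
  rw [← Finset.mul_sum, ← Finset.sum_div, ← powNorm_rpow hq0 hu, mul_div_assoc',
    div_le_one (by positivity)]
  have h1 := Real.rpow_le_rpow (by positivity) hρ'.le hq0.le
  rwa [Real.mul_rpow (by positivity) hT, ← Real.rpow_mul hC.le, one_div_mul_cancel hq0.ne',
    Real.rpow_one] at h1

/-- Averaging against `powerVec n q` turns the `ℓ_s`-norm, `q < s ≤ 2`, into the `ℓ_q`-norm. -/
theorem exists_permAvg_powerVec_equiv (hq : 1 < q) (hqs : q < s) (hs : s ≤ 2) :
    ∃ c C : ℝ, 0 < c ∧ 0 < C ∧ ∀ (n : ℕ) (u : Fin n → ℝ), 0 < n → (∀ k, 0 ≤ u k) →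
      c * powNorm q u ≤ permAvg (fun σ => powNorm s (fun j => u j * powerVec n q (σ j))) ∧
        permAvg (fun σ => powNorm s (fun j => u j * powerVec n q (σ j))) ≤ C * powNorm q u := by
  have hq0 : 0 < q := by linarith
  have hs1 : 1 < s := by linarith
  obtain ⟨C, hC, h⟩ := exists_orliczNorm_powerVec_le hq hqs hs
  refine ⟨3 / (20 * s) / 2, 2 * C, by positivity, by positivity, fun n u hn hu => ⟨?_, ?_⟩⟩
  · refine le_trans ?_ (orliczNorm_le_permAvg_powNorm hs1 (antitone_powerVec hq0)
      powerVec_nonneg hu)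
    rw [div_mul_eq_mul_div, mul_div_assoc]
    refine mul_le_mul_of_nonneg_left ?_ (by positivity)
    rw [div_le_iff₀' (by norm_num)]
    exact powNorm_le_orliczNorm_powerVec hq hs1 hn hu
  · refine (permAvg_powNorm_le_orliczNorm hs1 powerVec_nonneg
      (powerVec_ne_zero hn hq0) hu).trans ?_
    rw [mul_assoc]
    exact mul_le_mul_of_nonneg_left (h n u hu) (by norm_num)

end PowerVec

/-! ### Mixed norms and the triple average -/

section Mixed

variable {ι κ : Type*} [Fintype ι] [Fintype κ] {r s : ℝ}

theorem powNorm_anti (hr : 0 < r) (hrs : r ≤ s) {t : ι → ℝ} (ht : ∀ i, 0 ≤ t i) :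
    powNorm s t ≤ powNorm r t := by
  have hs : 0 < s := by linarith
  have hT := powNorm_nonneg (s := r) ht
  have key : ∑ i, t i ^ s ≤ powNorm r t ^ s := by
    have e : ∀ x : ℝ, 0 ≤ x → x ^ s = x ^ (s - r) * x ^ r := fun x hx => by
      rw [← Real.rpow_add_of_nonneg hx (by linarith) hr.le, sub_add_cancel]
    rw [e _ hT, powNorm_rpow hr ht, Finset.mul_sum]
    refine Finset.sum_le_sum fun i _ => ?_
    rw [e _ (ht i)]
    exact mul_le_mul_of_nonneg_right (Real.rpow_le_rpow (ht i) (le_powNorm hr ht i)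
      (by linarith)) (Real.rpow_nonneg (ht i) _)
  have h := Real.rpow_le_rpow (Finset.sum_nonneg fun i _ => Real.rpow_nonneg (ht i) _) key
    (by positivity : 0 ≤ 1 / s)
  rwa [← Real.rpow_mul hT, mul_one_div_cancel hs.ne', Real.rpow_one] at h

theorem powNorm_sum_le (hs : 1 ≤ s) {v : ι → κ → ℝ} (hv : ∀ i j, 0 ≤ v i j) :
    powNorm s (fun j => ∑ i, v i j) ≤ ∑ i, powNorm s (v i) := by
  classical
  have key : ∀ S : Finset ι, powNorm s (fun j => ∑ i ∈ S, v i j) ≤ ∑ i ∈ S, powNorm s (v i) := by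
    intro S
    induction S using Finset.induction_on with
    | empty => simp [powNorm, Real.zero_rpow (by linarith : s ≠ 0),
        Real.zero_rpow (by positivity : s⁻¹ ≠ 0)]
    | insert i S hi ih =>
      simp only [Finset.sum_insert hi]
      refine le_trans ?_ (add_le_add_right ih _)
      exact Real.Lp_add_le_of_nonneg Finset.univ hs (fun j _ => hv i j)
        fun j _ => Finset.sum_nonneg fun i _ => hv i j
  exact key Finset.univ

theorem powNorm_comm (hr : 0 < r) {v : ι → κ → ℝ} (hv : ∀ i j, 0 ≤ v i j) :
    powNorm r (fun i => powNorm r (v i)) = powNorm r (fun j => powNorm r (fun i => v i j)) := by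
  have h1 : ∀ i, powNorm r (v i) ^ r = ∑ j, v i j ^ r := fun i => powNorm_rpow hr (hv i)
  have h2 : ∀ j, powNorm r (fun i => v i j) ^ r = ∑ i, v i j ^ r := fun j =>
    powNorm_rpow hr fun i => hv i j
  rw [powNorm, powNorm]
  simp only [h1, h2]
  rw [Finset.sum_comm]

theorem powNorm_powNorm_le (hr : 0 < r) (hrs : r ≤ s) {v : ι → κ → ℝ} (hv : ∀ i j, 0 ≤ v i j) :
    powNorm r (fun i => powNorm s (v i)) ≤ powNorm r (fun j => powNorm r (fun i => v i j)) := by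
  rw [← powNorm_comm hr hv]
  exact powNorm_mono hr (fun i => powNorm_nonneg (hv i)) fun i => powNorm_anti hr hrs (hv i)

/-- Minkowski's inequality for mixed norms. -/
theorem powNorm_powNorm_ge (hr : 0 < r) (hrs : r ≤ s) {v : ι → κ → ℝ} (hv : ∀ i j, 0 ≤ v i j) :
    powNorm s (fun j => powNorm r (fun i => v i j)) ≤ powNorm r (fun i => powNorm s (v i)) := by
  have hs : 0 < s := by linarith
  have hvr : ∀ i j, 0 ≤ v i j ^ r := fun i j => Real.rpow_nonneg (hv i j) _
  have h := powNorm_sum_le ((one_le_div hr).2 hrs) hvr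
  have e1 : ∀ i, powNorm (s / r) (fun j => v i j ^ r) = powNorm s (v i) ^ r := fun i => by
    simp only [powNorm, ← Real.rpow_mul (hv i _), mul_div_cancel₀ s hr.ne']
    rw [← Real.rpow_mul (Finset.sum_nonneg fun j _ => Real.rpow_nonneg (hv i j) _), one_div_div,
      one_div_mul_eq_div]
  have e2 : powNorm (s / r) (fun j => ∑ i, v i j ^ r) =
      powNorm s (fun j => powNorm r (fun i => v i j)) ^ r := by
    have e3 : ∀ j, (∑ i, v i j ^ r) ^ (s / r) = powNorm r (fun i => v i j) ^ s := fun j => by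
      rw [powNorm, ← Real.rpow_mul (Finset.sum_nonneg fun i _ => hvr i j), one_div_mul_eq_div]
    simp only [powNorm, ← Real.rpow_mul (Finset.sum_nonneg fun i _ => hvr i _)]
    rw [← Real.rpow_mul (Finset.sum_nonneg fun j _ => Real.rpow_nonneg
      (Finset.sum_nonneg fun i _ => hvr i j) _), one_div_div, one_div_mul_eq_div]
    simp only [one_div_mul_eq_div]
  rw [e2] at h
  simp only [e1] at h
  have hB : ∀ i, 0 ≤ powNorm s (v i) := fun i => powNorm_nonneg (hv i)
  rw [← powNorm_rpow hr hB] at h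
  exact (Real.rpow_le_rpow_iff (powNorm_nonneg fun j => powNorm_nonneg fun i => hv i j)
    (powNorm_nonneg hB) hr).1 h

end Mixed

section Triple

variable {n : ℕ}

theorem mixedNorm_eq {r : ℝ} (hr : 0 < r) (M : ℝ → ℝ) (a : Matrix (Fin n) (Fin n) ℝ) :
    mixedNorm M r a = orliczNorm M (fun j => powNorm r (fun i => |a i j|)) := by
  have h : (ENNReal.ofReal r).toReal = r := ENNReal.toReal_ofReal hr.le
  rw [mixedNorm]
  congr 1
  funext j
  rw [PiLp.norm_eq_sum (by rwa [h]), h]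
  rfl

/-- The order of averaging is chosen so that `π` is evaluated first, then `η`, then `σ`. -/
theorem tripleAve_eq (x y z : Fin n → ℝ) (a : Matrix (Fin n) (Fin n) ℝ) :
    tripleAve x y z a = permAvg fun σ => permAvg fun η => permAvg fun π =>
      √(∑ i, ∑ j, |a i j * x (π i) * y (σ j) * z (η j)| ^ 2) := by
  simp only [tripleAve, permAvg, ← Finset.mul_sum]
  rw [← mul_assoc, ← mul_assoc, Finset.sum_comm]
  congr 1
  · field_simp
  · exact Finset.sum_congr rfl fun σ _ => Finset.sum_comm

theorem sqrt_sum_eq_powNorm {x y z : Fin n → ℝ} (hx : ∀ k, 0 ≤ x k) (hy : ∀ k, 0 ≤ y k)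
    (hz : ∀ k, 0 ≤ z k) (a : Matrix (Fin n) (Fin n) ℝ) (π σ η : Equiv.Perm (Fin n)) :
    √(∑ i, ∑ j, |a i j * x (π i) * y (σ j) * z (η j)| ^ 2) =
      powNorm 2 (fun i => powNorm 2 (fun j => |a i j| * y (σ j) * z (η j)) * x (π i)) := by
  rw [powNorm, Real.sqrt_eq_rpow]
  congr 1
  refine Finset.sum_congr rfl fun i _ => ?_
  have hv : ∀ j, 0 ≤ |a i j| * y (σ j) * z (η j) := fun j =>
    mul_nonneg (mul_nonneg (abs_nonneg _) (hy _)) (hz _)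
  rw [Real.mul_rpow (powNorm_nonneg hv) (hx _), powNorm_rpow two_pos hv, Finset.sum_mul]
  refine Finset.sum_congr rfl fun j _ => ?_
  rw [← Real.mul_rpow (hv j) (hx _), Real.rpow_two, abs_mul, abs_mul, abs_mul,
    abs_of_nonneg (hx _), abs_of_nonneg (hy _), abs_of_nonneg (hz _)]
  ring

theorem powNorm_col {y z : Fin n → ℝ} (hy : ∀ k, 0 ≤ y k) (hz : ∀ k, 0 ≤ z k) {r : ℝ}
    (hr : 0 < r) (a : Matrix (Fin n) (Fin n) ℝ) (j k l : Fin n) :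
    powNorm r (fun i => |a i j| * y k * z l) = powNorm r (fun i => |a i j|) * y k * z l := by
  have h := powNorm_mul hr (mul_nonneg (hy k) (hz l)) fun i => abs_nonneg (a i j)
  rw [show powNorm r (fun i => |a i j|) * y k * z l =
    y k * z l * powNorm r (fun i => |a i j|) by ring, ← h]
  congr 1
  funext i
  ring

theorem exists_tripleAve_equiv {p r : ℝ} (hp : 1 < p) (hpr : p < r) (hr : r < 2) :
    ∃ c C : ℝ, 0 < c ∧ 0 < C ∧ ∀ (n : ℕ) (y : Fin n → ℝ), y ≠ 0 → Antitone y →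
      (∀ i, 0 ≤ y i) → ∀ a : Matrix (Fin n) (Fin n) ℝ,
        c * mixedNorm (avgOrlicz p y) r a ≤ tripleAve (powerVec n r) y (powerVec n p) a ∧
        tripleAve (powerVec n r) y (powerVec n p) a ≤ C * mixedNorm (avgOrlicz p y) r a := by
  have hr0 : 0 < r := by linarith
  have hp0 : 0 < p := by linarith
  obtain ⟨c₁, C₁, hc₁, hC₁, h₁⟩ := exists_permAvg_powerVec_equiv (hp.trans hpr) hr le_rfl
  obtain ⟨c₂, _, hc₂, _, h₂⟩ := exists_permAvg_powerVec_equiv hp (hpr.trans hr) le_rfl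
  obtain ⟨_, C₃, _, hC₃, h₃⟩ := exists_permAvg_powerVec_equiv hp hpr hr.le
  -- `h₁` handles `π` (from `ℓ_2` to `ℓ_r`). For `η`, the lower bound starts from `ℓ_2` (`h₂`) and
  -- the upper from `ℓ_r` (`h₃`); both end in `ℓ_p`.
  refine ⟨c₁ * (c₂ * (3 / (20 * p))), C₁ * (C₃ * 2), by positivity, by positivity,
    fun n y hy0 hya hy a => ?_⟩
  obtain ⟨k, -⟩ := Function.ne_iff.1 hy0
  have hn : 0 < n := Fin.pos k
  rw [tripleAve_eq, mixedNorm_eq hr0]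
  simp only [sqrt_sum_eq_powNorm powerVec_nonneg hy powerVec_nonneg]
  set N : Fin n → ℝ := fun j => powNorm r (fun i => |a i j|) with hN
  have hN0 : ∀ j, 0 ≤ N j := fun j => powNorm_nonneg fun i => abs_nonneg _
  have hv : ∀ (σ η : Equiv.Perm (Fin n)) (i j : Fin n),
      0 ≤ |a i j| * y (σ j) * powerVec n p (η j) := fun σ η i j =>
    mul_nonneg (mul_nonneg (abs_nonneg _) (hy _)) (powerVec_nonneg _)
  have hNy : ∀ (σ : Equiv.Perm (Fin n)) (j : Fin n), 0 ≤ N j * y (σ j) := fun σ j =>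
    mul_nonneg (hN0 j) (hy _)
  constructor
  · calc c₁ * (c₂ * (3 / (20 * p))) * orliczNorm (avgOrlicz p y) N
        = c₁ * (c₂ * (3 / (20 * p) * orliczNorm (avgOrlicz p y) N)) := by ring
      _ ≤ c₁ * (c₂ * permAvg fun σ => powNorm p (fun j => N j * y (σ j))) := by
        gcongr
        exact orliczNorm_le_permAvg_powNorm hp hya hy hN0
      _ = permAvg fun σ => c₁ * (c₂ * powNorm p (fun j => N j * y (σ j))) := by
        rw [permAvg_const_mul, permAvg_const_mul]
      _ ≤ _ := permAvg_mono fun σ => ?_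
    calc c₁ * (c₂ * powNorm p (fun j => N j * y (σ j)))
        ≤ c₁ * permAvg fun η => powNorm 2 (fun j => N j * y (σ j) * powerVec n p (η j)) := by
          gcongr
          exact (h₂ n _ hn (hNy σ)).1
      _ = permAvg fun η => c₁ * powNorm 2 (fun j => N j * y (σ j) * powerVec n p (η j)) := by
        rw [permAvg_const_mul]
      _ ≤ _ := permAvg_mono fun η => ?_
    refine le_trans (mul_le_mul_of_nonneg_left ?_ hc₁.le)
      (h₁ n _ hn fun i => powNorm_nonneg (hv σ η i)).1
    refine le_trans (le_of_eq ?_) (powNorm_powNorm_ge hr0 hr.le (hv σ η))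
    simp only [powNorm_col hy powerVec_nonneg hr0, hN]
  · calc _ ≤ permAvg fun σ => C₁ * (C₃ * powNorm p (fun j => N j * y (σ j))) :=
          permAvg_mono fun σ => ?_
      _ = C₁ * (C₃ * permAvg fun σ => powNorm p (fun j => N j * y (σ j))) := by
        rw [permAvg_const_mul, permAvg_const_mul]
      _ ≤ C₁ * (C₃ * (2 * orliczNorm (avgOrlicz p y) N)) := by
        gcongr
        exact permAvg_powNorm_le_orliczNorm hp hy hy0 hN0
      _ = _ := by ring
    calc _ ≤ permAvg fun η => C₁ * powNorm r (fun j => N j * y (σ j) * powerVec n p (η j)) :=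
          permAvg_mono fun η => ?_
      _ = C₁ * permAvg fun η => powNorm r (fun j => N j * y (σ j) * powerVec n p (η j)) := by
        rw [permAvg_const_mul]
      _ ≤ _ := by
        gcongr
        exact (h₃ n _ hn (hNy σ)).2
    refine ((h₁ n _ hn fun i => powNorm_nonneg (hv σ η i)).2).trans
      (mul_le_mul_of_nonneg_left ?_ hC₁.le)
    refine (powNorm_powNorm_le hr0 hr.le (hv σ η)).trans (le_of_eq ?_)
    simp only [powNorm_col hy powerVec_nonneg hr0, hN]

/-- The triple average is equivalent to the mixed norm of any associated Orlicz function. -/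
theorem exists_tripleAve_equiv_of_isAssociated {p r A B : ℝ} (hp : 1 < p) (hpr : p < r)
    (hr : r < 2) (hA : 0 < A) (hB : 0 < B) :
    ∃ c C : ℝ, 0 < c ∧ 0 < C ∧ ∀ (n : ℕ) (y : Fin n → ℝ), y ≠ 0 → Antitone y →
      (∀ i, 0 ≤ y i) → ∀ M : ℝ → ℝ, IsOrlicz M → IsAssociated A B p y M →
      ∀ a : Matrix (Fin n) (Fin n) ℝ,
        c * mixedNorm M r a ≤ tripleAve (powerVec n r) y (powerVec n p) a ∧
        tripleAve (powerVec n r) y (powerVec n p) a ≤ C * mixedNorm M r a := by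
  have hr0 : 0 < r := by linarith
  have hp0 : 0 < p := by linarith
  obtain ⟨c, C, hc, hC, h⟩ := exists_tripleAve_equiv hp hpr hr
  -- The factors `3 * B` and `(p + 2) / A` compare the inverse duals through `targetFun`; the 6
  -- comes from `orliczNorm_le_of_orliczDualInv_le`.
  refine ⟨c / (6 * (3 * B)), C * (6 * ((p + 2) / A)), by positivity, by positivity,
    fun n y hy0 hya hy M hM hMy a => ?_⟩
  have hO := isOrlicz_avgOrlicz hp hy hy0
  have hOa := isAssociated_avgOrlicz hp hy0 hya hy
  have h1 : mixedNorm M r a ≤ 6 * (3 * B) * mixedNorm (avgOrlicz p y) r a := by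
    rw [mixedNorm_eq hr0, mixedNorm_eq hr0]
    refine orliczNorm_le_of_orliczDualInv_le hM hO (by positivity) (fun l hl hln => ?_) _
    have h2 := (hMy l hl hln).2
    have h3 := (hOa l hl hln).1
    nlinarith
  have h2 : mixedNorm (avgOrlicz p y) r a ≤ 6 * ((p + 2) / A) * mixedNorm M r a := by
    rw [mixedNorm_eq hr0, mixedNorm_eq hr0]
    refine orliczNorm_le_of_orliczDualInv_le hO hM (by positivity) (fun l hl hln => ?_) _
    have h2 := (hMy l hl hln).1
    have h3 := (hOa l hl hln).2
    rw [div_mul_eq_mul_div, le_div_iff₀ hA]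
    nlinarith
  obtain ⟨h3, h4⟩ := h n y hy0 hya hy a
  constructor
  · refine le_trans ?_ h3
    rw [div_mul_eq_mul_div, div_le_iff₀ (by positivity)]
    nlinarith
  · refine h4.trans ?_
    rw [mul_assoc]
    exact mul_le_mul_of_nonneg_left h2 hC.le

end Triple

/-! ### Khintchine's inequality -/

/-- The sign `±1` of a Boolean. -/
def boolSign (b : Bool) : ℝ := cond b 1 (-1)

section Khintchine

variable {ι : Type*} [Fintype ι] [DecidableEq ι]

theorem sum_prod_bool {R : Type*} [CommSemiring R] (f : ι → Bool → R) :
    ∑ ε : ι → Bool, ∏ i, f i (ε i) = ∏ i, (f i true + f i false) := by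
  have h := Finset.prod_univ_sum (fun _ : ι => (Finset.univ : Finset Bool)) f
  rw [Fintype.piFinset_univ] at h
  rw [← h]
  simp

theorem sum_boolSign_mul {k l : ι} (hkl : k ≠ l) :
    ∑ ε : ι → Bool, boolSign (ε k) * boolSign (ε l) = 0 := by
  have h := sum_prod_bool fun (i : ι) b =>
    (if i = k then boolSign b else 1) * (if i = l then boolSign b else 1)
  simp only [Finset.prod_mul_distrib, Finset.prod_ite_eq', Finset.mem_univ, if_true] at h
  rw [h]
  exact Finset.prod_eq_zero (Finset.mem_univ k) (by simp [hkl, boolSign])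

/-- Orthogonality of the signs gives the second moment; Cauchy–Schwarz does the rest. -/
theorem sum_abs_boolSign_le (a : ι → ℝ) :
    ∑ ε : ι → Bool, |∑ k, boolSign (ε k) * a k| ≤
      2 ^ Fintype.card ι * √(∑ k, a k ^ 2) := by
  have h1 : ∑ ε : ι → Bool, |∑ k, boolSign (ε k) * a k| ^ 2 =
      2 ^ Fintype.card ι * ∑ k, a k ^ 2 := by
    have e : ∀ ε : ι → Bool, |∑ k, boolSign (ε k) * a k| ^ 2 =
        ∑ k, ∑ l, a k * a l * (boolSign (ε k) * boolSign (ε l)) := fun ε => by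
      rw [sq_abs, sq, Finset.sum_mul_sum]
      exact Finset.sum_congr rfl fun k _ => Finset.sum_congr rfl fun l _ => by ring
    simp only [e]
    rw [Finset.sum_comm, Finset.mul_sum]
    refine Finset.sum_congr rfl fun k _ => ?_
    rw [Finset.sum_comm]
    simp only [← Finset.mul_sum]
    rw [Finset.sum_eq_single k (fun l _ hl => by rw [sum_boolSign_mul hl.symm, mul_zero])
      (fun h => absurd (Finset.mem_univ k) h)]
    have e2 : ∀ ε : ι → Bool, boolSign (ε k) * boolSign (ε k) = 1 := fun ε => by
      cases ε k <;> simp [boolSign]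
    simp only [e2, Finset.sum_const, Finset.card_univ, Fintype.card_pi, Fintype.card_bool,
      Finset.prod_const, nsmul_eq_mul, mul_one, Nat.cast_pow, Nat.cast_ofNat]
    ring
  have h2 := sq_sum_le_card_mul_sum_sq (s := (Finset.univ : Finset (ι → Bool)))
    (f := fun ε => |∑ k, boolSign (ε k) * a k|)
  simp only [h1, Finset.card_univ, Fintype.card_pi, Fintype.card_bool, Finset.prod_const,
    Nat.cast_pow, Nat.cast_ofNat] at h2
  refine abs_le_of_sq_le_sq' ?_ (by positivity) |>.2
  rw [mul_pow, Real.sq_sqrt (Finset.sum_nonneg fun k _ => sq_nonneg _)]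
  linarith

/-- The lower Khintchine inequality, by testing against the Riesz product `∏ (1 + i ε_k a_k)`. -/
theorem two_pow_mul_sqrt_le_sum_abs_boolSign (a : ι → ℝ) :
    Real.exp (-1 / 2) * (2 ^ Fintype.card ι * √(∑ k, a k ^ 2)) ≤
      ∑ ε : ι → Bool, |∑ k, boolSign (ε k) * a k| := by
  have normalized : ∀ a : ι → ℝ, ∑ k, a k ^ 2 = 1 → (2 : ℝ) ^ Fintype.card ι ≤
      Real.exp (1 / 2) * ∑ ε : ι → Bool, |∑ k, boolSign (ε k) * a k| := by
    intro a ha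
    set R : (ι → Bool) → ℂ := fun ε => ∏ k, (1 + Complex.I * boolSign (ε k) * a k) with hR
    -- Each factor has modulus `(1 + a_k²)^{1/2} ≤ exp (a_k² / 2)`.
    have hRn : ∀ ε, ‖R ε‖ ≤ Real.exp (1 / 2) := fun ε => by
      rw [hR, norm_prod, ← ha, Finset.sum_div, Real.exp_sum]
      refine Finset.prod_le_prod (fun k _ => norm_nonneg _) fun k _ => ?_
      refine abs_le_of_sq_le_sq' ?_ (Real.exp_pos _).le |>.2
      rw [Complex.sq_norm, ← Real.exp_nat_mul]
      have e : Complex.normSq (1 + Complex.I * boolSign (ε k) * a k) = 1 + a k ^ 2 := by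
        rw [Complex.normSq_apply]
        cases ε k <;> simp [boolSign] <;> ring
      rw [e]
      have := Real.add_one_le_exp (a k ^ 2)
      have e2 : ((2 : ℕ) : ℝ) * (a k ^ 2 / 2) = a k ^ 2 := by push_cast; ring
      rw [e2]
      linarith
    -- By independence, factors other than the `k`-th average to 1, and the `k`-th against its sign
    -- averages to `i a_k`.
    have hk : ∀ k, ∑ ε : ι → Bool, (boolSign (ε k) : ℂ) * R ε =
        2 ^ Fintype.card ι * (Complex.I * a k) := fun k => by
      have h := sum_prod_bool fun (i : ι) b =>
        (if i = k then (boolSign b : ℂ) else 1) * (1 + Complex.I * boolSign b * a i)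
      simp only [Finset.prod_mul_distrib, Finset.prod_ite_eq', Finset.mem_univ, if_true] at h
      rw [hR, h]
      have e : ∀ i, ((if i = k then (boolSign true : ℂ) else 1) *
          (1 + Complex.I * boolSign true * a i) + (if i = k then (boolSign false : ℂ) else 1) *
          (1 + Complex.I * boolSign false * a i)) =
          2 * (if i = k then Complex.I * a i else 1) := fun i => by
        split_ifs <;> simp [boolSign] <;> ring
      simp only [e, Finset.prod_mul_distrib, Finset.prod_ite_eq', Finset.mem_univ, if_true,
        Finset.prod_const, Finset.card_univ]
    have hsum : ∑ ε : ι → Bool, ((∑ k, boolSign (ε k) * a k : ℝ) : ℂ) * R ε =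
        2 ^ Fintype.card ι * Complex.I := by
      have e : ∀ ε : ι → Bool, ((∑ k, boolSign (ε k) * a k : ℝ) : ℂ) * R ε =
          ∑ k, (a k : ℂ) * ((boolSign (ε k) : ℂ) * R ε) := fun ε => by
        push_cast
        rw [Finset.sum_mul]
        exact Finset.sum_congr rfl fun k _ => by ring
      simp only [e]
      rw [Finset.sum_comm]
      simp only [← Finset.mul_sum, hk]
      have ha' : ∑ k, (a k : ℂ) ^ 2 = 1 := by exact_mod_cast ha
      calc ∑ k, (a k : ℂ) * (2 ^ Fintype.card ι * (Complex.I * a k))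
          = 2 ^ Fintype.card ι * Complex.I * ∑ k, (a k : ℂ) ^ 2 := by
            rw [Finset.mul_sum]
            exact Finset.sum_congr rfl fun k _ => by ring
        _ = _ := by rw [ha', mul_one]
    have hn : ‖∑ ε : ι → Bool, ((∑ k, boolSign (ε k) * a k : ℝ) : ℂ) * R ε‖ =
        2 ^ Fintype.card ι := by
      rw [hsum]; simp
    rw [← hn, Finset.mul_sum]
    refine (norm_sum_le _ _).trans (Finset.sum_le_sum fun ε _ => ?_)
    rw [norm_mul, Complex.norm_real, Real.norm_eq_abs, mul_comm]
    exact mul_le_mul_of_nonneg_right (hRn ε) (abs_nonneg _)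
  set q := √(∑ k, a k ^ 2) with hq
  have hq2 : q ^ 2 = ∑ k, a k ^ 2 := Real.sq_sqrt (Finset.sum_nonneg fun k _ => sq_nonneg _)
  rcases (Real.sqrt_nonneg (∑ k, a k ^ 2)).eq_or_lt with h0 | h0
  · rw [← hq] at h0
    rw [← h0, mul_zero, mul_zero]
    exact Finset.sum_nonneg fun ε _ => abs_nonneg _
  · rw [← hq] at h0
    have h := normalized (fun k => a k / q) (by
      simp only [div_pow, ← Finset.sum_div]
      rw [← hq2, div_self (by positivity)])
    simp only [← mul_div_assoc, ← Finset.sum_div, abs_div, abs_of_pos h0] at h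
    rw [le_div_iff₀ h0] at h
    have he : Real.exp (-1 / 2) * Real.exp (1 / 2) = 1 := by
      rw [← Real.exp_add]; norm_num
    calc _ ≤ Real.exp (-1 / 2) * (Real.exp (1 / 2) *
          ∑ ε : ι → Bool, |∑ k, boolSign (ε k) * a k|) :=
          mul_le_mul_of_nonneg_left h (Real.exp_pos _).le
      _ = _ := by rw [← mul_assoc, he, one_mul]

end Khintchine

/-! ### Embedding into `L₁[0,1]` -/

/-- The interval `(k/N, (k+1)/N]`. -/
def gridInterval (N k : ℕ) : Set ℝ := Set.Ioc ((k : ℝ) / N) (((k : ℝ) + 1) / N)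

section Embedding

variable {N : ℕ}

theorem gridInterval_unique {k l : ℕ} {x : ℝ} (hk : x ∈ gridInterval N k)
    (hl : x ∈ gridInterval N l) : k = l := by
  have key : ∀ k l : ℕ, x ∈ gridInterval N k → x ∈ gridInterval N l → ¬ k < l := by
    intro k l hk hl h
    have h1 : ((k : ℝ) + 1) / N ≤ l / N := by
      gcongr
      exact_mod_cast h
    exact absurd (hl.1.trans_le (hk.2.trans h1)) (lt_irrefl _)
  exact le_antisymm (not_lt.1 (key l k hl hk)) (not_lt.1 (key k l hk hl))

theorem measureReal_gridInterval (k : Fin N) :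
    (volume.restrict (Set.Icc (0 : ℝ) 1)).real (gridInterval N k) = 1 / N := by
  have hN : (0 : ℝ) < N := by exact_mod_cast Fin.pos k
  have hsub : gridInterval N k ⊆ Set.Icc 0 1 := fun x hx => by
    refine ⟨le_trans (by positivity) hx.1.le, hx.2.trans ?_⟩
    rw [div_le_one hN]
    exact_mod_cast k.2
  rw [measureReal_restrict_apply (by exact measurableSet_Ioc), Set.inter_eq_left.2 hsub, gridInterval,
    Real.volume_real_Ioc_of_le (by gcongr; linarith)]
  ring

/-- The step function with values `f k` on `(k/N, (k+1)/N]`. -/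
def stepFun (f : Fin N → ℝ) (x : ℝ) : ℝ :=
  ∑ k : Fin N, (gridInterval N k).indicator (fun _ => f k) x

theorem integrable_indicator_gridInterval (k : ℕ) (c : ℝ) :
    Integrable ((gridInterval N k).indicator fun _ => c)
      (volume.restrict (Set.Icc (0 : ℝ) 1)) :=
  (integrable_const c).indicator measurableSet_Ioc

theorem integrable_stepFun (f : Fin N → ℝ) :
    Integrable (stepFun f) (volume.restrict (Set.Icc (0 : ℝ) 1)) :=
  integrable_finsetSum _ fun k _ => integrable_indicator_gridInterval (k : ℕ) (f k)

theorem norm_stepFun (f : Fin N → ℝ) (x : ℝ) : ‖stepFun f x‖ = stepFun (fun k => |f k|) x := by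
  unfold stepFun
  by_cases hx : ∃ k : Fin N, x ∈ gridInterval N k
  · obtain ⟨k, hk⟩ := hx
    have h : ∀ g : Fin N → ℝ, ∑ l : Fin N, (gridInterval N l).indicator (fun _ => g l) x = g k := by
      intro g
      rw [Finset.sum_eq_single k (fun l _ hl => Set.indicator_of_notMem
        (fun hxl => hl (Fin.ext (gridInterval_unique hxl hk))) _)
        (fun h => absurd (Finset.mem_univ k) h), Set.indicator_of_mem hk]
    rw [h, h, Real.norm_eq_abs]
  · push Not at hx
    have h : ∀ g : Fin N → ℝ, ∑ l : Fin N, (gridInterval N l).indicator (fun _ => g l) x = 0 :=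
      fun g => Finset.sum_eq_zero fun l _ => Set.indicator_of_notMem (hx l) _
    rw [h, h, norm_zero]

theorem integral_stepFun (f : Fin N → ℝ) :
    ∫ x, stepFun f x ∂(volume.restrict (Set.Icc (0 : ℝ) 1)) = (1 / (N : ℝ)) * ∑ k, f k := by
  unfold stepFun
  rw [integral_finsetSum _ fun k _ => integrable_indicator_gridInterval _ _, Finset.mul_sum]
  refine Finset.sum_congr rfl fun k _ => ?_
  rw [integral_indicator_const _ (by exact measurableSet_Ioc), measureReal_gridInterval, smul_eq_mul]

/-- A finite set with uniform probability is modelled by disjoint intervals of equal length. -/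
theorem exists_linearMap_LOne (Ω : Type*) [Fintype Ω] :
    ∃ J : (Ω → ℝ) →ₗ[ℝ] LOne, ∀ f, ‖J f‖ = (1 / (Fintype.card Ω : ℝ)) * ∑ ω, |f ω| := by
  let e := (Fintype.equivFin Ω).symm
  refine ⟨{ toFun := fun f => (integrable_stepFun (f ∘ e)).toL1 _
            map_add' := fun f g => ?_
            map_smul' := fun c f => ?_ }, fun f => ?_⟩
  · rw [← Integrable.toL1_add]
    congr 1
    funext x
    simp only [stepFun, Pi.add_apply, Function.comp_apply, ← Finset.sum_add_distrib]
    exact Finset.sum_congr rfl fun k _ => by simp only [Set.indicator]; split_ifs <;> simp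
  · rw [RingHom.id_apply, ← Integrable.toL1_smul]
    congr 1
    funext x
    simp only [stepFun, Pi.smul_apply, Function.comp_apply, Finset.smul_sum]
    exact Finset.sum_congr rfl fun k _ => by simp only [Set.indicator]; split_ifs <;> simp
  · change ‖(integrable_stepFun (f ∘ e)).toL1 _‖ = _
    rw [L1.norm_of_fun_eq_integral_norm]
    simp only [norm_stepFun]
    rw [integral_stepFun, ← Equiv.sum_comp e]
    rfl

theorem isoSubspaceLOne_of_linearMap {V : Type*} [AddCommGroup V] [Module ℝ V] {N : V → ℝ}
    (T : V →ₗ[ℝ] LOne) {c C : ℝ} (hc : 0 < c) (hC : 0 < C) (h1 : ∀ v, c * N v ≤ ‖T v‖)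
    (h2 : ∀ v, ‖T v‖ ≤ C * N v) (hinj : Function.Injective T) :
    IsoSubspaceLOne N (C / c) := by
  refine ⟨LinearMap.range T, LinearEquiv.ofInjective T hinj, C, 1 / c, hC, by positivity,
    by rw [mul_one_div], fun v => h2 v, fun f => ?_⟩
  have h := h1 ((LinearEquiv.ofInjective T hinj).symm f)
  have e : T ((LinearEquiv.ofInjective T hinj).symm f) = f := by
    rw [← LinearEquiv.ofInjective_apply (h := hinj), LinearEquiv.apply_symm_apply]
  rw [e] at h
  rw [one_div_mul_eq_div, le_div_iff₀' hc]
  exact h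

end Embedding

/-! ### Random signs and the triple average -/

section Random

variable {n : ℕ}

/-- This gives injectivity of the embedding without showing that the mixed norm is definite. -/
theorem tripleAve_definite {x y z : Fin n → ℝ} (hx : ∀ k, x k ≠ 0) (hy : y ≠ 0)
    (hz : ∀ k, z k ≠ 0) {a : Matrix (Fin n) (Fin n) ℝ} (h : tripleAve x y z a = 0) : a = 0 := by
  obtain ⟨k, hk⟩ := Function.ne_iff.1 hy
  have hf : 1 / (n.factorial : ℝ) ^ 3 ≠ 0 := by
    have : (n.factorial : ℝ) ≠ 0 := by exact_mod_cast n.factorial_ne_zero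
    positivity
  have h1 := (mul_eq_zero.1 h).resolve_left hf
  ext i j
  -- Only `y` may vanish somewhere, so `σ` must send `j` to an index where it does not; the identity
  -- serves for `π` and `η`.
  have h2 := (Finset.sum_eq_zero_iff_of_nonneg fun π _ => Finset.sum_nonneg fun σ _ =>
    Finset.sum_nonneg fun η _ => Real.sqrt_nonneg _).1 h1 1 (Finset.mem_univ _)
  have h3 := (Finset.sum_eq_zero_iff_of_nonneg fun σ _ =>
    Finset.sum_nonneg fun η _ => Real.sqrt_nonneg _).1 h2 (Equiv.swap j k) (Finset.mem_univ _)
  have h4 := (Finset.sum_eq_zero_iff_of_nonneg fun η _ =>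
    Real.sqrt_nonneg _).1 h3 1 (Finset.mem_univ _)
  rw [Real.sqrt_eq_zero (Finset.sum_nonneg fun i _ => Finset.sum_nonneg fun j _ => sq_nonneg _),
    Finset.sum_eq_zero_iff_of_nonneg fun i _ => Finset.sum_nonneg fun j _ => sq_nonneg _] at h4
  have h5 := (Finset.sum_eq_zero_iff_of_nonneg fun j _ => sq_nonneg _).1
    (h4 i (Finset.mem_univ i)) j (Finset.mem_univ j)
  have hk' : y k ≠ 0 := hk
  simpa [hx, hz, hk'] using h5

/-- The random signed sums embed the triple average into `L₁[0,1]`. -/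
theorem exists_linearMap_tripleAve (x y z : Fin n → ℝ) :
    ∃ T : Matrix (Fin n) (Fin n) ℝ →ₗ[ℝ] LOne, ∀ a,
      Real.exp (-1 / 2) * tripleAve x y z a ≤ ‖T a‖ ∧ ‖T a‖ ≤ tripleAve x y z a := by
  obtain ⟨J, hJ⟩ := exists_linearMap_LOne (Equiv.Perm (Fin n) × Equiv.Perm (Fin n) ×
    Equiv.Perm (Fin n) × (Fin n × Fin n → Bool))
  let Λ : Matrix (Fin n) (Fin n) ℝ →ₗ[ℝ] (Equiv.Perm (Fin n) × Equiv.Perm (Fin n) ×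
      Equiv.Perm (Fin n) × (Fin n × Fin n → Bool) → ℝ) :=
    { toFun := fun a ω => ∑ k : Fin n × Fin n, boolSign (ω.2.2.2 k) *
        (a k.1 k.2 * x (ω.1 k.1) * y (ω.2.1 k.2) * z (ω.2.2.1 k.2))
      map_add' := fun a b => by
        funext ω
        simp only [Pi.add_apply, Matrix.add_apply, ← Finset.sum_add_distrib]
        exact Finset.sum_congr rfl fun k _ => by ring
      map_smul' := fun c a => by
        funext ω
        simp only [Pi.smul_apply, Matrix.smul_apply, smul_eq_mul, RingHom.id_apply,
          Finset.mul_sum]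
        exact Finset.sum_congr rfl fun k _ => by ring }
  refine ⟨J ∘ₗ Λ, fun a => ?_⟩
  set S : Equiv.Perm (Fin n) → Equiv.Perm (Fin n) → Equiv.Perm (Fin n) → ℝ := fun π σ η =>
    ∑ ε : Fin n × Fin n → Bool, |∑ k : Fin n × Fin n, boolSign (ε k) *
      (a k.1 k.2 * x (π k.1) * y (σ k.2) * z (η k.2))| with hS
  set D : ℝ := 2 ^ Fintype.card (Fin n × Fin n) with hD
  set Q : Equiv.Perm (Fin n) → Equiv.Perm (Fin n) → Equiv.Perm (Fin n) → ℝ := fun π σ η =>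
    √(∑ i, ∑ j, |a i j * x (π i) * y (σ j) * z (η j)| ^ 2) with hQ
  have hD0 : 0 < D := by positivity
  have hQe : ∀ π σ η, √(∑ k : Fin n × Fin n,
      (a k.1 k.2 * x (π k.1) * y (σ k.2) * z (η k.2)) ^ 2) = Q π σ η := fun π σ η => by
    simp only [hQ, sq_abs, Fintype.sum_prod_type]
  have hnorm : ‖(J ∘ₗ Λ) a‖ = (1 / (n.factorial : ℝ) ^ 3) *
      ∑ π, ∑ σ, ∑ η, D⁻¹ * S π σ η := by
    rw [LinearMap.comp_apply, hJ]
    simp only [Fintype.sum_prod_type, ← Finset.mul_sum]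
    rw [← mul_assoc]
    congr 1
    simp only [Fintype.card_prod, Fintype.card_perm, Fintype.card_fin, Fintype.card_pi,
      Fintype.card_bool, Finset.prod_const, Finset.card_univ, hD]
    push_cast
    rw [one_div, one_div, ← mul_inv]
    ring_nf
  have hlow : ∀ π σ η, Real.exp (-1 / 2) * Q π σ η ≤ D⁻¹ * S π σ η := fun π σ η => by
    rw [le_inv_mul_iff₀ hD0, ← hQe]
    have := two_pow_mul_sqrt_le_sum_abs_boolSign fun k : Fin n × Fin n =>
      a k.1 k.2 * x (π k.1) * y (σ k.2) * z (η k.2)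
    linarith
  have hup : ∀ π σ η, D⁻¹ * S π σ η ≤ Q π σ η := fun π σ η => by
    rw [inv_mul_le_iff₀ hD0, ← hQe]
    exact sum_abs_boolSign_le fun k : Fin n × Fin n =>
      a k.1 k.2 * x (π k.1) * y (σ k.2) * z (η k.2)
  rw [hnorm]
  constructor
  · have : Real.exp (-1 / 2) * tripleAve x y z a = (1 / (n.factorial : ℝ) ^ 3) *
        ∑ π, ∑ σ, ∑ η, Real.exp (-1 / 2) * Q π σ η := by
      simp only [tripleAve, ← Finset.mul_sum, hQ]
      ring
    rw [this]
    exact mul_le_mul_of_nonneg_left (Finset.sum_le_sum fun π _ => Finset.sum_le_sum fun σ _ =>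
      Finset.sum_le_sum fun η _ => hlow π σ η) (by positivity)
  · exact mul_le_mul_of_nonneg_left (Finset.sum_le_sum fun π _ => Finset.sum_le_sum fun σ _ =>
      Finset.sum_le_sum fun η _ => hup π σ η) (by positivity)

end Random

end

theorem mainTheorem2 (p r : ℝ) (hp : 1 < p) (hpr : p < r) (hr : r < 2) :
    (∃ A B : ℝ, 0 < A ∧ 0 < B ∧
      ∀ (n : ℕ) (y : Fin n → ℝ), y ≠ 0 → Antitone y → (∀ i, 0 ≤ y i) →
        ∃ M : ℝ → ℝ, IsOrlicz M ∧ IsAssociated A B p y M) ∧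
    (∀ A B : ℝ, 0 < A → 0 < B →
      ∃ c₁ c₂ C : ℝ, 0 < c₁ ∧ 0 < c₂ ∧
        ∀ (n : ℕ) (y : Fin n → ℝ), y ≠ 0 → Antitone y → (∀ i, 0 ≤ y i) →
          ∀ M : ℝ → ℝ, IsOrlicz M → IsAssociated A B p y M →
            (∀ a : Matrix (Fin n) (Fin n) ℝ,
              c₁ * mixedNorm M r a ≤ tripleAve (powerVec n r) y (powerVec n p) a ∧
                tripleAve (powerVec n r) y (powerVec n p) a ≤ c₂ * mixedNorm M r a) ∧
            IsoSubspaceLOne (fun a : Matrix (Fin n) (Fin n) ℝ => mixedNorm M r a) C) := by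
  refine ⟨⟨1 / 3, p + 2, by norm_num, by linarith, fun n y hy0 hya hy =>
    ⟨avgOrlicz p y, isOrlicz_avgOrlicz hp hy hy0, isAssociated_avgOrlicz hp hy0 hya hy⟩⟩,
    fun A B hA hB => ?_⟩
  obtain ⟨c, C, hc, hC, h⟩ := exists_tripleAve_equiv_of_isAssociated hp hpr hr hA hB
  -- The factor `exp (-1/2)` is the loss in the lower Khintchine inequality.
  refine ⟨c, C, C / (Real.exp (-1 / 2) * c), hc, hC, fun n y hy0 hya hy M hM hMy => ?_⟩
  have hM' := h n y hy0 hya hy M hM hMy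
  refine ⟨hM', ?_⟩
  obtain ⟨T, hT⟩ := exists_linearMap_tripleAve (powerVec n r) y (powerVec n p)
  refine isoSubspaceLOne_of_linearMap T (by positivity) hC (fun a => ?_)
    (fun a => (hT a).2.trans (hM' a).2) ((injective_iff_map_eq_zero T).2 fun a ha => ?_)
  · rw [mul_assoc]
    exact (mul_le_mul_of_nonneg_left (hM' a).1 (Real.exp_pos _).le).trans (hT a).1
  · have hpos : ∀ q : ℝ, 1 < q → ∀ k, powerVec n q k ≠ 0 := fun q hq k =>
      (zero_lt_one.trans_le (one_le_powerVec (by linarith) k)).ne'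
    refine tripleAve_definite (hpos r (hp.trans hpr)) hy0 (hpos p hp) (le_antisymm ?_ ?_)
    · have h1 := (hT a).1
      rw [ha, norm_zero] at h1
      exact nonpos_of_mul_nonpos_right h1 (Real.exp_pos _)
    · exact (norm_nonneg _).trans (hT a).2
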